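/- **Theorem 2 (Immediate Optimality in Separable Informational Environments).** *Environment.* Let $K\ge 1$ and let $\theta=(\theta_1,\dots,\theta_K)'\sim\mathcal N(\mu^0,V^0)$ be an unknown, persistent state vector, of which only $\theta_1$ is payoff-relevant. There are $K$ information sources; each observation of source $k$ has the form $X_k=\langle c_k,\theta\rangle+\epsilon_k$ with $\epsilon_k\sim\mathcal N(0,\sigma_k^2)$, $\sigma_k^2>0$, the error terms being independent of $\theta$, across sources and across observations. Let $C$ be the matrix with rows $c_k'$; assume that $C$ has full rank and that no proper subset of its rows spans the coordinate vector $e_1'$. For $q\in\mathbb Z_+^K$ let $f(q)$ be the posterior variance of $\theta_1$ after $q_k$ observations of each source $k$ (it does not depend on the realizations). *Decision problem.* Let $B\ge 1$. In each period $t=1,2,\dots$ the decision maker (DM) chooses $B$ sources, repetitions allowed, observes one new realization for each, and then takes an action $a_t$ in a measurable space $A_t$. An information acquisition strategy $S$ is a measurable map from histories of past realizations to blocks of $B$ sources; a decision strategy $A$ is a measurable map from histories of realizations, up to and including the current period, to actions. The payoff is $U(a_1,a_2,\dots;\theta_1)\in\mathbb R$ with $U$ an arbitrary measurable function. The expected payoff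 is $\mathbb E[U^+]-\mathbb E[U^-]\in[-\infty,+\infty]$, where $\infty-\infty$ is read as $-\infty$. A pair $(S,A)$ is optimal if no pair has a larger expected payoff. $S$ is myopic if in every period and at every history it prescribes a block which, added to the observations acquired so far, minimizes the posterior variance of $\theta_1$ among all blocks of $B$ sources. *Separability.* The environment is separable if there are convex functions $g_1,\dots,g_K:[0,\infty)\to(-\infty,+\infty]$ and a function $F$, strictly increasing on the set of values taken by $\sum_i g_i(q_i)$ for $q\in\mathbb Z_+^K$, such that $$f(q_1,\dots,q_K)=F\big(g_1(q_1)+\dots+g_K(q_K)\big)\qquad\text{for all } q\in\mathbb Z_+^K .$$ *Claim.* Suppose that the environment is separable. Then for every $B\ge 1$ there is an information acquisition strategy $S$, myopic from period $1$, that is optimal in every decision problem $\big((A_t)_{t\ge1},U\big)$ in the following sense: 1. for every strategy $(S',A')$, the expected payoff of $(S',A')$ is at most the supremum, over decision strategies $A$, of the expected payoff of $(S,A)$; 2. for every strategy $(S',A')$ whose expected payoff is not $+\infty$ there is a decision strategy $A$ such that the expected payoff of $(S,A)$ is at least that of $(S',A')$; 3. consequently, if the decision problem has an optimal strategy with expected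 payoff other than $+\infty$, then it has an optimal strategy $(S,A)$ that acquires information by the myopic rule $S$. -/

import Mathlib

open MeasureTheory ProbabilityTheory
open scoped NNReal ENNReal

noncomputable section

/-- An informational environment with `K` unknown states and `K` information sources: the prior
`N(μ₀, V₀)` of the state vector, the coefficient matrix `C` whose `k`-th row is the coefficient
vector of source `k`, and the positive noise variances. The payoff-relevant state is the one with
index `0`. -/
structure InfoEnv (K : ℕ) where
  priorMean : EuclideanSpace ℝ (Fin K)
  priorCov : Matrix (Fin K) (Fin K) ℝ
  coeff : Matrix (Fin K) (Fin K) ℝ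
  noiseVar : Fin K → ℝ≥0
  priorCov_posSemidef : priorCov.PosSemidef
  noiseVar_pos : ∀ k, 0 < noiseVar k

/-- An information acquisition strategy with block size `B`: after `t` periods, as a measurable
function of the `t * B` realizations observed so far, it prescribes the sources of the `B`
observations of the next period (repetitions allowed). Earlier choices are not listed in the
history because the strategy determines them from the earlier realizations. -/
structure AcqStrategy (K B : ℕ) where
  choose : (t : ℕ) → (Fin t → Fin B → ℝ) → (Fin B → Fin K)
  measurable_choose : ∀ t, Measurable (choose t)

/-- A decision strategy: the action of each period is a measurable function of the realizations
observed up to and including that period. -/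
structure DecisionStrategy (B : ℕ) (Act : ℕ → Type*) [∀ t, MeasurableSpace (Act t)] where
  act : (t : ℕ) → (Fin (t + 1) → Fin B → ℝ) → Act t
  measurable_act : ∀ t, Measurable (act t)

/-- The number of times each source occurs in a block. -/
def blockCount {K B : ℕ} (s : Fin B → Fin K) (k : Fin K) : ℕ :=
  (Finset.univ.filter fun b => s b = k).card

/-- The division vector: how many observations of each source the strategy has acquired in the
first `t` periods along the history `h`. -/
def AcqStrategy.division {K B : ℕ} (S : AcqStrategy K B) (t : ℕ) (h : Fin t → Fin B → ℝ)
    (k : Fin K) : ℕ :=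
  ∑ s : Fin t, blockCount (S.choose s fun i => h (Fin.castLE s.isLt.le i)) k

namespace InfoEnv

variable {K : ℕ} (E : InfoEnv K)

/-- Non-redundancy: `C` has full rank, and no proper subset of its rows spans the first coordinate
vector. -/
def NonRedundant [NeZero K] : Prop :=
  IsUnit E.coeff.det ∧
    ∀ T : Set (Fin K), T ≠ Set.univ →
      (Pi.single 0 1 : Fin K → ℝ) ∉ Submodule.span ℝ (E.coeff '' T)

/-- The prior distribution of the state vector. -/
def prior : Measure (EuclideanSpace ℝ (Fin K)) :=
  multivariateGaussian E.priorMean E.priorCov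

/-- `⟨c_k, θ⟩`, the mean of source `k` in state `θ`. -/
def signalMean (θ : EuclideanSpace ℝ (Fin K)) (k : Fin K) : ℝ :=
  ∑ j, E.coeff k j * θ j

/-! ### The posterior variance function -/

/-- The joint law of the state vector and of the independent errors of `q k` observations of each
source `k`. -/
def sampleLaw (q : Fin K → ℕ) :
    Measure (EuclideanSpace ℝ (Fin K) × ((k : Fin K) → Fin (q k) → ℝ)) :=
  E.prior.prod (Measure.pi fun k => Measure.pi fun _ => gaussianReal 0 (E.noiseVar k))

/-- The values of `q k` observations of each source `k`. -/
def sampleObs (q : Fin K → ℕ) (ω : EuclideanSpace ℝ (Fin K) × ((k : Fin K) → Fin (q k) → ℝ)) :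
    (k : Fin K) → Fin (q k) → ℝ :=
  fun k j => E.signalMean ω.1 k + ω.2 k j

/-- The posterior variance of the payoff-relevant state after `q k` observations of each source
`k`. In this Gaussian model the conditional variance is almost surely constant; its mean is that
constant. -/
def posteriorVar [NeZero K] (q : Fin K → ℕ) : ℝ :=
  ∫ ω, (Var[fun ω => ω.1 0; E.sampleLaw q |
    MeasurableSpace.comap (E.sampleObs q) inferInstance]) ω ∂(E.sampleLaw q)

/-- Separability of the environment: `f q = F (∑ i, g i (q i))` with convex `g i` on `[0, ∞)` and
`F` strictly increasing (on the values that the sum takes). The `g i` may take the value `+∞`, as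
for `g i x = σ² / x` with `g i 0 = +∞`; convexity is convexity of the epigraph. -/
def Separable [NeZero K] : Prop :=
  ∃ (g : Fin K → ℝ → EReal) (F : EReal → ℝ),
    (∀ i x, 0 ≤ x → g i x ≠ ⊥) ∧
    (∀ i, Convex ℝ {p : ℝ × ℝ | 0 ≤ p.1 ∧ g i p.1 ≤ (p.2 : EReal)}) ∧
    StrictMonoOn F (Set.range fun q : Fin K → ℕ => ∑ i, g i (q i : ℝ)) ∧
    ∀ q : Fin K → ℕ, E.posteriorVar q = F (∑ i, g i (q i : ℝ))

/-- A strategy is myopic if in every period, at every history, the prescribed block, combined with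
the observations acquired so far, leads to the lowest posterior variance of the payoff-relevant
state among all blocks of `B` sources. -/
def IsMyopic [NeZero K] {B : ℕ} (S : AcqStrategy K B) : Prop :=
  ∀ (t : ℕ) (h : Fin t → Fin B → ℝ) (s : Fin B → Fin K),
    E.posteriorVar (S.division t h + blockCount (S.choose t h)) ≤
      E.posteriorVar (S.division t h + blockCount s)

/-! ### The dynamic decision problem -/

/-- The joint law of the state vector and of all the errors: the error of an observation of source
`k` made in period `t` as the `b`-th one of its block is the coordinate `(t, b, k)`, and all of
them are independent. -/
def law (B : ℕ) : Measure (EuclideanSpace ℝ (Fin K) × (ℕ → Fin B → Fin K → ℝ)) :=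
  E.prior.prod (Measure.infinitePi fun _ : ℕ =>
    Measure.pi fun _ : Fin B => Measure.pi fun k => gaussianReal 0 (E.noiseVar k))

/-- The realizations observed in the first `t` periods under the strategy `S`. -/
def history {B : ℕ} (S : AcqStrategy K B)
    (ω : EuclideanSpace ℝ (Fin K) × (ℕ → Fin B → Fin K → ℝ)) : (t : ℕ) → Fin t → Fin B → ℝ
  | 0 => Fin.elim0
  | t + 1 => Fin.snoc (α := fun _ => Fin B → ℝ) (history S ω t) fun b =>
      E.signalMean ω.1 (S.choose t (history S ω t) b) +
        ω.2 t b (S.choose t (history S ω t) b)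

variable {B : ℕ} {Act : ℕ → Type*} [∀ t, MeasurableSpace (Act t)]

/-- The realized payoff of the strategy `(S, A)` in the decision problem with payoff function `U`
of the sequence of actions and the payoff-relevant state. -/
def payoff [NeZero K] (U : ((t : ℕ) → Act t) → ℝ → ℝ) (S : AcqStrategy K B)
    (A : DecisionStrategy B Act)
    (ω : EuclideanSpace ℝ (Fin K) × (ℕ → Fin B → Fin K → ℝ)) : ℝ :=
  U (fun t => A.act t (E.history S ω (t + 1))) (ω.1 0)

/-- The expected payoff, as the extended real number `E[U⁺] - E[U⁻]`; an undefined expectation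
`∞ - ∞` counts as `-∞`. -/
def expectedPayoff [NeZero K] (U : ((t : ℕ) → Act t) → ℝ → ℝ) (S : AcqStrategy K B)
    (A : DecisionStrategy B Act) : EReal :=
  ((∫⁻ ω, ENNReal.ofReal (E.payoff U S A ω) ∂(E.law B) : ℝ≥0∞) : EReal) -
    ((∫⁻ ω, ENNReal.ofReal (-E.payoff U S A ω) ∂(E.law B) : ℝ≥0∞) : EReal)

/-- The strategy `(S, A)` is optimal: no strategy has a larger expected payoff. -/
def IsOptimal [NeZero K] (U : ((t : ℕ) → Act t) → ℝ → ℝ) (S : AcqStrategy K B)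
    (A : DecisionStrategy B Act) : Prop :=
  ∀ (S' : AcqStrategy K B) (A' : DecisionStrategy B Act),
    E.expectedPayoff U S' A' ≤ E.expectedPayoff U S A

end InfoEnv

end

/-!
In a separable environment with convex `g i` the greedy algorithm, which always adds an observation
of a source with the smallest marginal value of `g i`, minimizes the posterior variance over all
division vectors of each total at once, so the deterministic strategy following it has the lowest
posterior variance in every period among all strategies. Since signals are Gaussian, the experiment
conducted up to a given period leaves the payoff-relevant state Gaussian with a mean depending on
the history and a variance depending only on the division vector. An experiment with the smaller
variance is more informative in the sense of Blackwell: adding independent noise to its posterior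
mean yields the law of the posterior mean of the other experiment, and, period by period, the
signals of any other strategy can be redrawn from their conditional law given the simulated past and
this posterior mean. A decision maker following the greedy strategy can thus replicate the payoff of
any other strategy by a randomized decision strategy, and a realization of the randomization does at
least as well.
-/

noncomputable section

/-! ### Greedy minimization of separable convex functions -/

section Greedy

variable {ι L : Type*} [Fintype ι]

/-- The allocation `m` of `∑ i, m i` units to the indices minimizes the separable cost
`∑ i, G i (m i)` among all allocations of the same number of units. -/
def IsMinAllocation [Preorder L] [AddCommMonoid L] (G : ι → ℕ → L) (m : ι → ℕ) : Prop :=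
  ∀ q : ι → ℕ, ∑ i, q i = ∑ i, m i → ∑ i, G i (m i) ≤ ∑ i, G i (q i)

variable [DecidableEq ι]

lemma sum_add_single_one (q : ι → ℕ) (i : ι) :
    ∑ k, (q + Pi.single i 1 : ι → ℕ) k = ∑ k, q k + 1 := by
  simp [Finset.sum_add_distrib]

lemma sum_apply_add_single_one [AddCommGroup L] (G : ι → ℕ → L) (q : ι → ℕ) (i : ι) :
    ∑ k, G k ((q + Pi.single i 1 : ι → ℕ) k) = ∑ k, G k (q k) + (G i (q i + 1) - G i (q i)) := by
  rw [← sub_eq_iff_eq_add', ← Finset.sum_sub_distrib, Finset.sum_eq_single i]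
  · simp
  · intro k _ hk
    simp [hk]
  · simp

lemma IsMinAllocation.add_single_one [AddCommGroup L] [LinearOrder L] [IsOrderedAddMonoid L]
    {G : ι → ℕ → L} {m : ι → ℕ} (hm : IsMinAllocation G m)
    (hG : ∀ i, Monotone fun n => G i (n + 1) - G i n) {i : ι}
    (hi : ∀ k, G i (m i + 1) - G i (m i) ≤ G k (m k + 1) - G k (m k)) :
    IsMinAllocation G (m + Pi.single i 1) := by
  intro q hq
  rw [sum_add_single_one] at hq
  obtain ⟨k, -, hk⟩ : ∃ k ∈ Finset.univ, m k < q k := Finset.exists_lt_of_sum_lt (by omega)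
  obtain ⟨q', rfl⟩ : ∃ q', q = q' + Pi.single k 1 := by
    refine ⟨q - Pi.single k 1, (tsub_add_cancel_of_le fun i => ?_).symm⟩
    rcases eq_or_ne i k with rfl | hik
    · simpa [Nat.one_le_iff_ne_zero] using hk.pos.ne'
    · simp [hik]
  have hmq : m k ≤ q' k := by simpa [Nat.lt_succ_iff] using hk
  rw [sum_add_single_one, Nat.add_right_cancel_iff] at hq
  rw [sum_apply_add_single_one, sum_apply_add_single_one]
  exact add_le_add (hm q' hq) ((hi k).trans (hG k hmq))

omit [Fintype ι] in
lemma count_eq_succ (j : ℕ → ι) (n : ℕ) :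
    (fun i => Nat.count (j · = i) (n + 1)) =
      (fun i => Nat.count (j · = i) n) + Pi.single (j n) 1 := by
  ext i
  simp [Nat.count_succ, Pi.single_apply, eq_comm]

lemma sum_count_eq (j : ℕ → ι) (n : ℕ) : ∑ i, Nat.count (j · = i) n = n := by
  induction n with
  | zero => simp
  | succ n ih =>
    have h := sum_add_single_one (fun i => Nat.count (j · = i) n) (j n)
    rwa [← count_eq_succ, ih] at h

lemma exists_isMinAllocation_count [Nonempty ι] [AddCommGroup L] [LinearOrder L]
    [IsOrderedAddMonoid L] {G : ι → ℕ → L} (hG : ∀ i, Monotone fun n => G i (n + 1) - G i n) :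
    ∃ j : ℕ → ι, ∀ n, IsMinAllocation G fun i => Nat.count (j · = i) n := by
  choose next hnext using fun m : ι → ℕ => Finite.exists_min fun i => G i (m i + 1) - G i (m i)
  let path : ℕ → ι → ℕ := fun n => (fun m => m + Pi.single (next m) 1)^[n] 0
  have path_succ (n : ℕ) : path (n + 1) = path n + Pi.single (next (path n)) 1 :=
    Function.iterate_succ_apply' _ _ _
  have count_eq_path (n : ℕ) : (fun i => Nat.count (fun a => next (path a) = i) n) = path n := by
    induction n with
    | zero => ext i; simp [path]
    | succ n ih => rw [count_eq_succ, ih, path_succ]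
  refine ⟨fun n => next (path n), fun n => ?_⟩
  rw [count_eq_path]
  induction n with
  | zero =>
    intro q hq
    have hq_zero : q = 0 := by simpa [path, funext_iff] using hq
    rw [hq_zero]
    rfl
  | succ n ih =>
    rw [path_succ]
    exact ih.add_single_one hG (hnext (path n))

end Greedy

lemma two_mul_sq_sub_one_lt {x : ℕ} (hx : 0 < x) :
    2 * ((x - 1 : ℕ) : ℤ) ^ 2 < (x : ℤ) ^ 2 + ((x - 2 : ℕ) : ℤ) ^ 2 := by
  rcases x with _ | _ | x
  · exact absurd hx (lt_irrefl 0)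
  · simp
  · push_cast [Nat.add_sub_cancel, Nat.add_sub_add_right]
    nlinarith

lemma two_mul_sq_sub_one_le (x : ℕ) :
    2 * ((x - 1 : ℕ) : ℤ) ^ 2 ≤ (x : ℤ) ^ 2 + ((x - 2 : ℕ) : ℤ) ^ 2 := by
  rcases x.eq_zero_or_pos with rfl | hx
  · simp
  · exact (two_mul_sq_sub_one_lt hx).le

lemma ordConnected_nat_cases {s : Set ℕ} (hs : s.OrdConnected) :
    s = ∅ ∨ (∃ a, s = Set.Ici a) ∨ ∃ a b, s = Set.Icc a b := by
  rcases s.eq_empty_or_nonempty with rfl | hne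
  · exact Or.inl rfl
  have hInf {n : ℕ} (hn : n ∈ s) : sInf s ≤ n := Nat.sInf_le hn
  right
  by_cases hb : BddAbove s
  · refine Or.inr ⟨sInf s, sSup s, Set.Subset.antisymm (fun n hn => ⟨hInf hn, le_csSup hb hn⟩) ?_⟩
    exact hs.out (Nat.sInf_mem hne) (Nat.sSup_mem hne hb)
  · refine Or.inl ⟨sInf s, Set.Subset.antisymm (fun n hn => hInf hn) fun n hn => ?_⟩
    obtain ⟨m, hm, hnm⟩ := not_bddAbove_iff.1 hb n
    exact hs.out (Nat.sInf_mem hne) hm ⟨hn, hnm.le⟩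

lemma exists_penalty {s : Set ℕ} (hs : s.OrdConnected) :
    ∃ c : ℕ → ℤ, (∀ n, 0 ≤ c n) ∧ (∀ n, c n = 0 ↔ n ∈ s) ∧
      ∀ n, (n ∈ s ∧ n + 2 ∈ s) ∨ c (n + 1) - c n < c (n + 2) - c (n + 1) := by
  rcases ordConnected_nat_cases hs with rfl | ⟨a, rfl⟩ | ⟨a, b, rfl⟩
  · refine ⟨fun n => n ^ 2 + 1, fun n => by positivity, fun n => ?_, fun n => Or.inr ?_⟩
    · simpa using (by positivity : (n : ℤ) ^ 2 + 1 ≠ 0)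
    · push_cast
      linarith
  · refine ⟨fun n => ((a - n : ℕ) : ℤ) ^ 2, fun n => by positivity, fun n => ?_, fun n => ?_⟩
    · simp [Nat.sub_eq_zero_iff_le]
    · rcases le_or_gt a n with h | h
      · exact Or.inl ⟨h, le_add_right h⟩
      · have := two_mul_sq_sub_one_lt (Nat.sub_pos_of_lt h)
        simp only [Nat.sub_sub] at this
        exact Or.inr (by linarith)
  · refine ⟨fun n => ((a - n : ℕ) : ℤ) ^ 2 + ((n - b : ℕ) : ℤ) ^ 2, fun n => by positivity,
      fun n => ?_, fun n => ?_⟩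
    · rw [add_eq_zero_iff_of_nonneg (by positivity) (by positivity)]
      simp [Nat.sub_eq_zero_iff_le]
    · have left := two_mul_sq_sub_one_le (a - n)
      have right := two_mul_sq_sub_one_le (n + 2 - b)
      have left_lt := @two_mul_sq_sub_one_lt (a - n)
      have right_lt := @two_mul_sq_sub_one_lt (n + 2 - b)
      rw [Nat.sub_right_comm, Nat.sub_right_comm _ b 2] at right right_lt
      simp only [Nat.sub_sub, Nat.add_sub_cancel, Nat.reduceSubDiff, tsub_pos_iff_lt] at *
      rcases lt_or_ge n a with h | h
      · exact Or.inr (by linarith [left_lt h])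
      rcases lt_or_ge b (n + 2) with h' | h'
      · exact Or.inr (by linarith [right_lt h'])
      · exact Or.inl ⟨⟨h, by omega⟩, by omega, h'⟩

lemma ordConnected_setOf_natCast_ne_top {g : ℝ → EReal}
    (hconv : Convex ℝ {p : ℝ × ℝ | 0 ≤ p.1 ∧ g p.1 ≤ (p.2 : EReal)}) :
    {n : ℕ | g n ≠ ⊤}.OrdConnected := by
  have h : {n : ℕ | g n ≠ ⊤} =
      Nat.cast ⁻¹' (Prod.fst '' {p : ℝ × ℝ | 0 ≤ p.1 ∧ g p.1 ≤ (p.2 : EReal)}) := by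
    ext n
    constructor
    · intro hn
      exact ⟨(n, (g n).toReal), ⟨n.cast_nonneg, EReal.le_coe_toReal hn⟩, rfl⟩
    · rintro ⟨⟨x, y⟩, ⟨-, hy⟩, rfl : x = n⟩
      exact ne_top_of_le_ne_top (EReal.coe_ne_top y) hy
  rw [h]
  exact (hconv.linear_image (LinearMap.fst ℝ ℝ ℝ)).ordConnected.preimage_mono Nat.mono_cast

lemma toReal_sub_toReal_le_of_convex_epigraph {g : ℝ → EReal} (hbot : ∀ x, 0 ≤ x → g x ≠ ⊥)
    (hconv : Convex ℝ {p : ℝ × ℝ | 0 ≤ p.1 ∧ g p.1 ≤ (p.2 : EReal)}) {n : ℕ}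
    (hn : g n ≠ ⊤) (hn2 : g (n + 2 : ℕ) ≠ ⊤) :
    (g (n + 1 : ℕ)).toReal - (g n).toReal ≤ (g (n + 2 : ℕ)).toReal - (g (n + 1 : ℕ)).toReal := by
  have hmid := hconv (x := (n, (g n).toReal)) ⟨n.cast_nonneg, EReal.le_coe_toReal hn⟩
    (y := ((n + 2 : ℕ), (g (n + 2 : ℕ)).toReal)) ⟨Nat.cast_nonneg _, EReal.le_coe_toReal hn2⟩
    (a := 1 / 2) (b := 1 / 2) (by norm_num) (by norm_num) (by norm_num)
  have hpoint : (1 / 2 : ℝ) * n + 1 / 2 * ((n + 2 : ℕ) : ℝ) = (n + 1 : ℕ) := by push_cast; ring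
  have hle : g (n + 1 : ℕ) ≤ ((1 / 2 * (g n).toReal + 1 / 2 * (g (n + 2 : ℕ)).toReal : ℝ)) := by
    have h := hmid.2
    rwa [Prod.fst_add, Prod.snd_add, Prod.smul_mk, Prod.smul_mk, smul_eq_mul, smul_eq_mul,
      smul_eq_mul, smul_eq_mul, hpoint] at h
  have := EReal.toReal_le_toReal hle (hbot _ (Nat.cast_nonneg _)) (EReal.coe_ne_top _)
  rw [EReal.toReal_coe] at this
  linarith

/- `+∞` becomes a positive first coordinate in the lexicographic plane, where the penalty outside
the domain is chosen strictly convex so that the second coordinate is free there. -/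
lemma exists_lex_representation {g : ℝ → EReal} (hbot : ∀ x, 0 ≤ x → g x ≠ ⊥)
    (hconv : Convex ℝ {p : ℝ × ℝ | 0 ≤ p.1 ∧ g p.1 ≤ (p.2 : EReal)}) :
    ∃ G : ℕ → ℤ ×ₗ ℝ, Monotone (fun n => G (n + 1) - G n) ∧ ∀ n : ℕ,
      0 ≤ (ofLex (G n)).1 ∧ ((ofLex (G n)).1 = 0 ↔ g n ≠ ⊤) ∧
      (ofLex (G n)).2 = (g n).toReal := by
  obtain ⟨c, c_nonneg, c_eq_zero, c_convex⟩ :=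
    exists_penalty (ordConnected_setOf_natCast_ne_top hconv)
  refine ⟨fun n => toLex (c n, (g n).toReal), monotone_nat_of_le_succ fun n => ?_,
    fun n => ⟨c_nonneg n, c_eq_zero n, rfl⟩⟩
  rw [Prod.Lex.le_iff]
  rcases c_convex n with ⟨hn, hn2⟩ | h
  · have hn1 := (ordConnected_setOf_natCast_ne_top hconv).out hn hn2
      ⟨n.le_succ, (n + 1).le_succ⟩
    refine Or.inr ⟨?_, toReal_sub_toReal_le_of_convex_epigraph hbot hconv hn hn2⟩
    simp [(c_eq_zero _).2 hn, (c_eq_zero _).2 hn1, (c_eq_zero _).2 hn2]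
  · exact Or.inl h

lemma ofLex_sum {ι α β : Type*} [AddCommMonoid α] [AddCommMonoid β] (s : Finset ι)
    (f : ι → α ×ₗ β) :
    ofLex (∑ i ∈ s, f i) = (∑ i ∈ s, (ofLex (f i)).1, ∑ i ∈ s, (ofLex (f i)).2) := by
  rw [← Prod.fst_sum, ← Prod.snd_sum]
  exact map_sum (⟨⟨ofLex, rfl⟩, fun _ _ => rfl⟩ : (α ×ₗ β) →+ α × β) f s

lemma sum_eq_top {ι : Type*} [Fintype ι] {x : ι → EReal} (hbot : ∀ i, x i ≠ ⊥)
    {i : ι} (hi : x i = ⊤) : ∑ i, x i = ⊤ := by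
  classical
  rw [← Finset.add_sum_erase _ _ (Finset.mem_univ i), hi]
  refine EReal.top_add_of_ne_bot (Finset.sum_induction _ (· ≠ ⊥) (fun a b ha hb => ?_) (by simp)
    fun k _ => hbot k)
  simp [EReal.add_eq_bot_iff, ha, hb]

lemma sum_eq_coe_sum_toReal {ι : Type*} [Fintype ι] {x : ι → EReal} (hbot : ∀ i, x i ≠ ⊥)
    (htop : ∀ i, x i ≠ ⊤) : ∑ i, x i = ((∑ i, (x i).toReal : ℝ) : EReal) := by
  have := map_sum (⟨⟨Real.toEReal, EReal.coe_zero⟩, EReal.coe_add⟩ : ℝ →+ EReal)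
    (fun i => (x i).toReal) Finset.univ
  refine (Finset.sum_congr rfl fun i _ => ?_).trans this.symm
  exact (EReal.coe_toReal (htop i) (hbot i)).symm

lemma exists_count_sum_le {ι : Type*} [Fintype ι] [DecidableEq ι] [Nonempty ι]
    {g : ι → ℝ → EReal} (hbot : ∀ i x, 0 ≤ x → g i x ≠ ⊥)
    (hconv : ∀ i, Convex ℝ {p : ℝ × ℝ | 0 ≤ p.1 ∧ g i p.1 ≤ (p.2 : EReal)}) :
    ∃ j : ℕ → ι, ∀ (n : ℕ) (q : ι → ℕ), ∑ i, q i = n →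
      ∑ i, g i (Nat.count (j · = i) n : ℕ) ≤ ∑ i, g i (q i) := by
  choose G hmono hnonneg hzero hreal using fun i => exists_lex_representation (hbot i) (hconv i)
  obtain ⟨j, hj⟩ := exists_isMinAllocation_count hmono
  refine ⟨j, fun n q hq => ?_⟩
  have hbot' (p : ι → ℕ) (i : ι) : g i (p i) ≠ ⊥ := hbot i _ (Nat.cast_nonneg _)
  by_cases hq_top : ∃ i, g i (q i) = ⊤
  · obtain ⟨i, hi⟩ := hq_top
    exact (sum_eq_top (hbot' q) hi).ge.trans' le_top
  push Not at hq_top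
  set m : ι → ℕ := fun i => Nat.count (j · = i) n
  have hlex := hj n q (hq.trans (sum_count_eq j n).symm)
  simp only [Prod.Lex.le_iff, ofLex_sum, Finset.sum_eq_zero fun i _ => (hzero i _).2 (hq_top i),
    hreal] at hlex
  have hm_nonneg : 0 ≤ ∑ i, (ofLex (G i (m i))).1 := Finset.sum_nonneg fun i _ => hnonneg i _
  obtain ⟨hm_zero, hle⟩ := hlex.resolve_left hm_nonneg.not_gt
  rw [Finset.sum_eq_zero_iff_of_nonneg fun i _ => hnonneg i _] at hm_zero
  have hm_top (i : ι) : g i (m i) ≠ ⊤ := (hzero i _).1 (hm_zero i (Finset.mem_univ i))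
  rw [sum_eq_coe_sum_toReal (hbot' m) hm_top, sum_eq_coe_sum_toReal (hbot' q) hq_top]
  exact_mod_cast hle

/-! ### Division vectors of strategies -/

variable {K B : ℕ}

lemma sum_blockCount (s : Fin B → Fin K) : ∑ k, blockCount s k = B := by
  have := Finset.card_eq_sum_card_fiberwise (s := Finset.univ) (f := s) (t := Finset.univ)
    fun b _ => Finset.mem_coe.2 (Finset.mem_univ (s b))
  exact this.symm.trans (Finset.card_fin B)

lemma count_add_eq_count_add_blockCount (j : ℕ → Fin K) (n : ℕ) :
    (fun k => Nat.count (j · = k) (n + B)) =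
      (fun k => Nat.count (j · = k) n) + blockCount fun b : Fin B => j (n + b) := by
  ext k
  rw [Nat.count_add, Pi.add_apply, Nat.count_eq_card_filter_range _ B, Finset.card_filter,
    Finset.sum_range, blockCount, Finset.card_filter]

namespace AcqStrategy

lemma sum_division (S : AcqStrategy K B) (t : ℕ) (h : Fin t → Fin B → ℝ) :
    ∑ k, S.division t h k = t * B := by
  unfold division
  rw [Finset.sum_comm]
  simp [sum_blockCount]

lemma division_succ (S : AcqStrategy K B) (t : ℕ) (h : Fin (t + 1) → Fin B → ℝ) :
    S.division (t + 1) h =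
      S.division t (Fin.init h) + blockCount (S.choose t (Fin.init h)) := by
  ext k
  simp only [division, Fin.sum_univ_castSucc, Pi.add_apply]
  rfl

/-- The strategy that acquires the sources `j 0, j 1, …` in this order, `B` per period, whatever
it observes. -/
def ofSeq (j : ℕ → Fin K) (B : ℕ) : AcqStrategy K B where
  choose t _ b := j (t * B + b)
  measurable_choose _ := measurable_const

lemma division_ofSeq (j : ℕ → Fin K) (B t : ℕ) (h : Fin t → Fin B → ℝ) :
    (ofSeq j B).division t h = fun k => Nat.count (j · = k) (t * B) := by
  induction t with
  | zero => ext k; simp [division]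
  | succ t ih =>
    rw [division_succ, ih, Nat.succ_mul, count_add_eq_count_add_blockCount]
    rfl

end AcqStrategy

namespace InfoEnv

variable [NeZero K] {E : InfoEnv K}

/-- A strategy is totally optimal if at every history its observations achieve the lowest posterior
variance of the payoff-relevant state among all division vectors of the same total. -/
def IsTotallyOptimal (E : InfoEnv K) (S : AcqStrategy K B) : Prop :=
  ∀ (t : ℕ) (h : Fin t → Fin B → ℝ) (q : Fin K → ℕ), ∑ k, q k = t * B →
    E.posteriorVar (S.division t h) ≤ E.posteriorVar q

lemma IsTotallyOptimal.isMyopic {S : AcqStrategy K B} (hS : E.IsTotallyOptimal S) :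
    E.IsMyopic S := by
  intro t h s
  have hdiv := S.division_succ t (Fin.snoc h 0)
  rw [Fin.init_snoc] at hdiv
  rw [← hdiv]
  refine hS (t + 1) _ _ ?_
  simp [Finset.sum_add_distrib, AcqStrategy.sum_division, sum_blockCount, Nat.succ_mul]

lemma Separable.exists_isTotallyOptimal (hsep : E.Separable) (B : ℕ) :
    ∃ S : AcqStrategy K B, E.IsTotallyOptimal S := by
  obtain ⟨g, F, hbot, hconv, hF, hf⟩ := hsep
  obtain ⟨j, hj⟩ := exists_count_sum_le hbot hconv
  refine ⟨AcqStrategy.ofSeq j B, fun t h q hq => ?_⟩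
  rw [AcqStrategy.division_ofSeq, hf, hf]
  exact hF.monotoneOn ⟨_, rfl⟩ ⟨_, rfl⟩ (hj (t * B) q hq)

end InfoEnv

/-! ### Gaussian conditioning -/

section Conditioning

variable {Ω ι : Type*} [MeasurableSpace Ω] [Fintype ι] {P : Measure Ω} [IsProbabilityMeasure P]

lemma covariance_eq_inner_toLp {X Y : Ω → ℝ} (hX : MemLp X 2 P) (hY : MemLp Y 2 P) :
    cov[X, Y; P] = inner ℝ ((hX.sub (memLp_const P[X])).toLp _)
      ((hY.sub (memLp_const P[Y])).toLp _) := by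
  rw [L2.inner_def, covariance]
  refine integral_congr_ae ?_
  filter_upwards [(hX.sub (memLp_const P[X])).coeFn_toLp,
    (hY.sub (memLp_const P[Y])).coeFn_toLp] with ω hXω hYω
  simp [hXω, hYω, mul_comm]

/-- Least squares: the coefficients are those of the orthogonal projection in `L²` of the centered
`Y` onto the span of the centered `X i`. -/
lemma exists_uncorrelated_residual {X : ι → Ω → ℝ} {Y : Ω → ℝ} (hX : ∀ i, MemLp (X i) 2 P)
    (hY : MemLp Y 2 P) :
    ∃ w : ι → ℝ, ∀ i, cov[X i, fun ω => Y ω - ∑ j, w j * X j ω; P] = 0 := by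
  let x i := ((hX i).sub (memLp_const P[X i])).toLp _
  let y := (hY.sub (memLp_const P[Y])).toLp _
  let V := Submodule.span ℝ (Set.range x)
  have : FiniteDimensional ℝ V := FiniteDimensional.span_of_finite ℝ (Set.finite_range x)
  obtain ⟨w, hw⟩ := (Submodule.mem_span_range_iff_exists_fun ℝ).1 (V.starProjection_apply_mem y)
  refine ⟨w, fun i => ?_⟩
  have horth : inner ℝ (x i) (y - ∑ j, w j • x j) = 0 := by
    rw [hw]
    exact V.sub_starProjection_mem_orthogonal y _ (Submodule.subset_span ⟨i, rfl⟩)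
  rw [covariance_fun_sub_right (hX i) hY (memLp_finsetSum _ fun j _ => (hX j).const_mul _),
    covariance_fun_sum_right (fun j => (hX j).const_mul _) (hX i)]
  simp_rw [covariance_const_mul_right, covariance_eq_inner_toLp (hX i) hY,
    covariance_eq_inner_toLp (hX i) (hX _)]
  simpa [inner_sub_right, inner_sum, inner_smul_right] using horth

end Conditioning

/-- The conditional law of `Y` given `X` is Gaussian with mean `m X` and variance `v X`; it is
encoded by the joint law, as that of `X` and `m X + √(v X) ξ` with an independent standard normal
`ξ`. -/
structure CondGaussian {Ω α : Type*} [MeasurableSpace Ω] [MeasurableSpace α] (P : Measure Ω)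
    (X : Ω → α) (Y : Ω → ℝ) (m v : α → ℝ) : Prop where
  measurable_obs : Measurable X
  measurable_target : Measurable Y
  measurable_mean : Measurable m
  measurable_var : Measurable v
  identDistrib : IdentDistrib (fun ω => (X ω, Y ω))
    (fun p : Ω × ℝ => (X p.1, m (X p.1) + √(v (X p.1)) * p.2)) P (P.prod (gaussianReal 0 1))

lemma identDistrib_comp_of_measurePreserving {Ω Ω' α : Type*} [MeasurableSpace Ω]
    [MeasurableSpace Ω'] [MeasurableSpace α] {P : Measure Ω} {P' : Measure Ω'} {e : Ω → Ω'}
    (he : MeasurePreserving e P P') {X : Ω' → α} (hX : AEMeasurable X P') :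
    IdentDistrib (fun ω => X (e ω)) X P P' :=
  (he.hasLaw.identDistrib .id).comp_of_aemeasurable (by rwa [he.map_eq])

lemma identDistrib_prod_right {Ω Ω' α β : Type*} [MeasurableSpace Ω] [MeasurableSpace Ω']
    [MeasurableSpace α] [MeasurableSpace β] {P : Measure Ω} {P' : Measure Ω'} [SFinite P]
    [SFinite P'] {X : Ω → α} {X' : Ω' → α} (hX : Measurable X) (hX' : Measurable X')
    (h : IdentDistrib X X' P P') (ρ : Measure β) [SFinite ρ] :
    IdentDistrib (fun p : Ω × β => (X p.1, p.2)) (fun p : Ω' × β => (X' p.1, p.2)) (P.prod ρ)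
      (P'.prod ρ) where
  aemeasurable_fst := by fun_prop
  aemeasurable_snd := by fun_prop
  map_eq := by
    have hprod := Measure.map_prod_map P ρ hX measurable_id
    rw [h.map_eq, Measure.map_prod_map P' ρ hX' measurable_id] at hprod
    exact hprod.symm

lemma hasLaw_sqrt_mul_snd {Ω : Type*} [MeasurableSpace Ω] {P : Measure Ω} [IsProbabilityMeasure P]
    (w : ℝ≥0) :
    HasLaw (fun p : Ω × ℝ => √(w : ℝ) * p.2) (gaussianReal 0 w) (P.prod (gaussianReal 0 1)) := by
  have hξ : HasLaw Prod.snd (gaussianReal 0 1) (P.prod (gaussianReal 0 1)) :=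
    measurePreserving_snd.hasLaw
  have hw : NNReal.mk (√(w : ℝ) ^ 2) (sq_nonneg _) * 1 = w := by ext; simp
  simpa only [mul_zero, hw] using gaussianReal_const_mul hξ √(w : ℝ)

namespace CondGaussian

variable {Ω α : Type*} [MeasurableSpace Ω] [MeasurableSpace α] {P : Measure Ω}
  {X : Ω → α} {Y : Ω → ℝ} {m v : α → ℝ}

lemma of_identDistrib {Ω' : Type*} [MeasurableSpace Ω'] {P' : Measure Ω'}
    [SFinite P] [SFinite P'] {X' : Ω' → α} {Y' : Ω' → ℝ} (h : CondGaussian P X Y m v)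
    (hX' : Measurable X') (hY' : Measurable Y')
    (hXY : IdentDistrib (fun ω => (X' ω, Y' ω)) (fun ω => (X ω, Y ω)) P' P) :
    CondGaussian P' X' Y' m v where
  measurable_obs := hX'
  measurable_target := hY'
  measurable_mean := h.measurable_mean
  measurable_var := h.measurable_var
  identDistrib := by
    have hm := h.measurable_mean
    have hv := h.measurable_var
    refine (hXY.trans h.identDistrib).trans ?_
    exact (identDistrib_prod_right h.measurable_obs hX' (hXY.comp measurable_fst).symm
      (gaussianReal 0 1)).comp (u := fun q => (q.1, m q.1 + √(v q.1) * q.2)) (by fun_prop)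

lemma map_equiv {β : Type*} [MeasurableSpace β] (e : α ≃ᵐ β) (h : CondGaussian P X Y m v) :
    CondGaussian P (fun ω => e (X ω)) Y (fun y => m (e.symm y)) fun y => v (e.symm y) where
  measurable_obs := e.measurable.comp h.measurable_obs
  measurable_target := h.measurable_target
  measurable_mean := h.measurable_mean.comp e.symm.measurable
  measurable_var := h.measurable_var.comp e.symm.measurable
  identDistrib := by
    have := h.identDistrib.comp (u := Prod.map e id) (by fun_prop)
    simpa only [Function.comp_def, Prod.map, e.symm_apply_apply, id] using this

lemma identDistrib_residual {w : ℝ} (h : CondGaussian P X Y m fun _ => w) :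
    IdentDistrib (fun ω => (X ω, Y ω - m (X ω))) (fun p : Ω × ℝ => (X p.1, √w * p.2)) P
      (P.prod (gaussianReal 0 1)) := by
  have hm := h.measurable_mean
  have := h.identDistrib.comp (u := fun q => (q.1, q.2 - m q.1)) (by fun_prop)
  simpa only [Function.comp_def, add_sub_cancel_left] using this

variable [IsProbabilityMeasure P]

lemma of_indepFun_residual {w : ℝ≥0} (hX : Measurable X) (hY : Measurable Y) (hm : Measurable m)
    (hind : IndepFun X (fun ω => Y ω - m (X ω)) P)
    (hlaw : HasLaw (fun ω => Y ω - m (X ω)) (gaussianReal 0 w) P) :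
    CondGaussian P X Y m fun _ => w where
  measurable_obs := hX
  measurable_target := hY
  measurable_mean := hm
  measurable_var := measurable_const
  identDistrib := by
    have hobs : IdentDistrib X (fun p : Ω × ℝ => X p.1) P (P.prod (gaussianReal 0 1)) :=
      HasLaw.identDistrib (κ := P.map X) ⟨hX.aemeasurable, rfl⟩
        (HasLaw.comp ⟨hX.aemeasurable, rfl⟩ (measurePreserving_fst (μ := P)).hasLaw)
    have hpair := hobs.prodMk (hlaw.identDistrib (hasLaw_sqrt_mul_snd w)) hind
      (indepFun_prod hX (measurable_const_mul _))
    have := hpair.comp (u := fun q => (q.1, m q.1 + q.2)) (by fun_prop)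
    simpa only [Function.comp_def, add_sub_cancel] using this

lemma indepFun_residual {w : ℝ} (h : CondGaussian P X Y m fun _ => w) :
    IndepFun X (fun ω => Y ω - m (X ω)) P :=
  indepFun_of_identDistrib_pair (indepFun_prod h.measurable_obs (measurable_const_mul √w))
    h.identDistrib_residual.symm

lemma hasLaw_residual {w : ℝ≥0} (h : CondGaussian P X Y m fun _ => w) :
    HasLaw (fun ω => Y ω - m (X ω)) (gaussianReal 0 w) P :=
  (h.identDistrib_residual.symm.comp measurable_snd).hasLaw (hasLaw_sqrt_mul_snd w)

lemma integral_condVar {w : ℝ≥0} (h : CondGaussian P X Y m fun _ => w) (hY : Integrable Y P) :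
    ∫ ω, (Var[Y; P | MeasurableSpace.comap X inferInstance]) ω ∂P = w := by
  have hle := h.measurable_obs.comap_le
  have hR := h.hasLaw_residual
  set R : Ω → ℝ := fun ω => Y ω - m (X ω) with hRdef
  have hRm : Measurable R := h.measurable_target.sub (h.measurable_mean.comp h.measurable_obs)
  have hRint : Integrable R P := hR.hasGaussianLaw.integrable
  have hRmean : P[R] = 0 := by rw [hR.integral_eq, integral_id_gaussianReal]
  have hcond : P[Y | MeasurableSpace.comap X inferInstance] =ᵐ[P] fun ω => m (X ω) := by
    have hmX : Integrable (fun ω => m (X ω)) P := by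
      simpa [hRdef, sub_eq_add_neg, Pi.add_def] using hY.sub hRint
    have hYdecomp : Y = (fun ω => m (X ω)) + R := by ext ω; simp [R]
    have hcondR : P[R | MeasurableSpace.comap X inferInstance] =ᵐ[P] fun _ => P[R] :=
      condExp_indep_eq hRm.comap_le hle (comap_measurable R).stronglyMeasurable
        h.indepFun_residual.symm
    have hcondm : P[fun ω => m (X ω) | MeasurableSpace.comap X inferInstance] = fun ω => m (X ω) :=
      condExp_of_stronglyMeasurable hle
        (h.measurable_mean.comp (comap_measurable X)).stronglyMeasurable hmX
    rw [hYdecomp]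
    filter_upwards [condExp_add hmX hRint _, hcondR] with ω hadd hRω
    rw [hadd, Pi.add_apply, hcondm, hRω, hRmean, add_zero]
  rw [condVar, integral_condExp hle]
  calc ∫ ω, ((Y - P[Y | MeasurableSpace.comap X inferInstance]) ^ 2) ω ∂P
      = ∫ ω, R ω ^ 2 ∂P := by
        refine integral_congr_ae ?_
        filter_upwards [hcond] with ω hω
        simp [hω, R]
    _ = Var[R; P] := (variance_of_integral_eq_zero hRm.aemeasurable hRmean).symm
    _ = w := by rw [hR.variance_eq, variance_id_gaussianReal]

end CondGaussian

lemma exists_condGaussian_of_hasGaussianLaw {Ω ι : Type*} [MeasurableSpace Ω] [Finite ι]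
    {P : Measure Ω} {X : Ω → ι → ℝ} {Y : Ω → ℝ} (hX : Measurable X) (hY : Measurable Y)
    (h : HasGaussianLaw (fun ω => (X ω, Y ω)) P) :
    ∃ (m : (ι → ℝ) → ℝ) (w : ℝ≥0), CondGaussian P X Y m fun _ => w := by
  have := Fintype.ofFinite ι
  have := h.isProbabilityMeasure
  obtain ⟨w, hw⟩ := exists_uncorrelated_residual (fun i => (h.fst.eval i).memLp_two)
    h.snd.memLp_two
  let R : Ω → ℝ := fun ω => Y ω - ∑ j, w j * X ω j
  let L : (ι → ℝ) × ℝ →L[ℝ] (ι → ℝ) × (Unit → ℝ) :=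
    (ContinuousLinearMap.fst ℝ _ _).prod (ContinuousLinearMap.pi fun _ =>
      ContinuousLinearMap.snd ℝ _ _ -
        (∑ j, w j • ContinuousLinearMap.proj (R := ℝ) (φ := fun _ : ι => ℝ) j).comp
          (ContinuousLinearMap.fst ℝ _ _))
  have hXR : HasGaussianLaw (fun ω => (X ω, fun _ : Unit => R ω)) P := by
    have hL : (fun ω => (X ω, fun _ : Unit => R ω)) = fun ω => L (X ω, Y ω) := by
      ext <;> simp [L, R]
    exact hL ▸ h.map_fun L
  have hind : IndepFun X (fun ω (_ : Unit) => R ω) P :=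
    hXR.indepFun_of_covariance_eval (X := fun i ω => X ω i) (Y := fun _ => R) fun i _ => hw i
  have hR : HasLaw R (gaussianReal P[R] Var[R; P].toNNReal) P :=
    ⟨(hXR.snd.eval ()).aemeasurable, (hXR.snd.eval ()).map_eq_gaussianReal⟩
  have hres : (fun ω => Y ω - (∑ j, w j * X ω j + P[R])) = fun ω => R ω - P[R] := by
    ext ω; simp only [R]; ring
  refine ⟨fun x => ∑ j, w j * x j + P[R], Var[R; P].toNNReal,
    .of_indepFun_residual hX hY (by fun_prop) ?_ ?_⟩ <;> rw [hres]
  · exact hind.comp (ψ := fun f => f () - P[R]) measurable_id (by fun_prop)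
  · simpa using gaussianReal_sub_const hR P[R]

lemma restrict_map_eq_of_eqOn {Ω α : Type*} [MeasurableSpace Ω] [MeasurableSpace α]
    {P : Measure Ω} {X Z : Ω → α} (hX : Measurable X) (hZ : Measurable Z) {s : Set α}
    (hs : MeasurableSet s) (h : ∀ ω, X ω ∈ s ∨ Z ω ∈ s → X ω = Z ω) :
    (P.map X).restrict s = (P.map Z).restrict s := by
  ext t ht
  rw [Measure.restrict_apply ht, Measure.restrict_apply ht, Measure.map_apply hX (ht.inter hs),
    Measure.map_apply hZ (ht.inter hs)]
  congr 1
  ext ω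
  constructor <;> intro hω
  · exact (h ω (.inl hω.2) ▸ hω : Z ω ∈ t ∩ s)
  · exact ((h ω (.inr hω.2)).symm ▸ hω : X ω ∈ t ∩ s)

section Partition

variable {Ω Ω' α κ : Type*} [MeasurableSpace Ω] [MeasurableSpace Ω'] [MeasurableSpace α]
  [Countable κ] [MeasurableSpace κ] [MeasurableSingletonClass κ] {P : Measure Ω} {P' : Measure Ω'}
  {c : α → κ}

lemma identDistrib_of_partition (hc : Measurable c) {X : Ω → α} {X' : Ω' → α} {Z : κ → Ω → α}
    {Z' : κ → Ω' → α} (hX : Measurable X) (hX' : Measurable X') (hZ : ∀ k, Measurable (Z k))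
    (hZ' : ∀ k, Measurable (Z' k)) (h : ∀ k, IdentDistrib (Z k) (Z' k) P P')
    (hXZ : ∀ k ω, c (X ω) = k ∨ c (Z k ω) = k → X ω = Z k ω)
    (hXZ' : ∀ k ω, c (X' ω) = k ∨ c (Z' k ω) = k → X' ω = Z' k ω) :
    IdentDistrib X X' P P' where
  aemeasurable_fst := hX.aemeasurable
  aemeasurable_snd := hX'.aemeasurable
  map_eq := by
    refine Measure.ext_of_iUnion_eq_univ (s := fun k => c ⁻¹' {k})
      (Set.eq_univ_of_forall fun x => Set.mem_iUnion.2 ⟨c x, rfl⟩) fun k => ?_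
    have hs : MeasurableSet (c ⁻¹' {k}) := hc (measurableSet_singleton k)
    rw [restrict_map_eq_of_eqOn hX (hZ k) hs (hXZ k), (h k).map_eq,
      restrict_map_eq_of_eqOn hX' (hZ' k) hs (hXZ' k)]

lemma condGaussian_of_partition (hc : Measurable c) {X : Ω → α} {Y : Ω → ℝ} {Z : κ → Ω → α}
    {m v : κ → α → ℝ} (hX : Measurable X) (hY : Measurable Y)
    (h : ∀ k, CondGaussian P (Z k) Y (m k) (v k))
    (hXZ : ∀ k ω, c (X ω) = k ∨ c (Z k ω) = k → X ω = Z k ω) :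
    CondGaussian P X Y (fun x => m (c x) x) (fun x => v (c x) x) := by
  have hglue {f : κ → α → ℝ} (hf : ∀ k, Measurable (f k)) : Measurable fun x => f (c x) x :=
    (measurable_from_prod_countable_right (f := Function.uncurry f) hf).comp
      (hc.prodMk measurable_id)
  have hm := hglue fun k => (h k).measurable_mean
  have hv := hglue fun k => (h k).measurable_var
  have hsim {X : Ω → α} (hX : Measurable X) {m v : α → ℝ} (hm : Measurable m) (hv : Measurable v) :
      Measurable fun p : Ω × ℝ => (X p.1, m (X p.1) + √(v (X p.1)) * p.2) := by fun_prop
  refine ⟨hX, hY, hm, hv, identDistrib_of_partition (hc.comp measurable_fst) (hX.prodMk hY)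
    (hsim hX hm hv) (fun k => (h k).measurable_obs.prodMk hY)
    (fun k => hsim (h k).measurable_obs (h k).measurable_mean (h k).measurable_var)
    (fun k => (h k).identDistrib) (fun k ω hω => by rw [hXZ k ω hω]) fun k p hp => ?_⟩
  have hXk := hXZ k p.1 hp
  have hck : c (X p.1) = k := hp.elim id fun hZk => hXk ▸ hZk
  simp only [hXk ▸ hck, hXk]

end Partition

/-! ### Posterior of the payoff-relevant state -/

lemma isGaussian_pi {ι : Type*} [Fintype ι] {E : ι → Type*} [∀ i, NormedAddCommGroup (E i)]
    [∀ i, NormedSpace ℝ (E i)] [∀ i, MeasurableSpace (E i)] [∀ i, BorelSpace (E i)]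
    [∀ i, SecondCountableTopology (E i)] [∀ i, CompleteSpace (E i)] (μ : ∀ i, Measure (E i))
    [∀ i, IsGaussian (μ i)] : IsGaussian (Measure.pi μ) := by
  have h : HasGaussianLaw (fun (x : ∀ i, E i) i => x i) (Measure.pi μ) :=
    iIndepFun.hasGaussianLaw (X := fun i (x : ∀ i, E i) => x i)
      (fun i => (measurePreserving_eval μ i).hasLaw.hasGaussianLaw)
      (iIndepFun_pi (X := fun _ => id) fun _ => aemeasurable_id)
  simpa using h.isGaussian_map

lemma exists_equiv_of_schedule {t : ℕ} (d : Fin t → Fin B → Fin K) :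
    ∃ σ : ((k : Fin K) × Fin ((∑ s, blockCount (d s)) k)) ≃ Fin t × Fin B,
      ∀ p, d (σ p).1 (σ p).2 = p.1 := by
  have hcard (k : Fin K) :
      Fintype.card {p : Fin t × Fin B // d p.1 p.2 = k} = (∑ s, blockCount (d s)) k := by
    rw [Fintype.card_subtype, Finset.card_filter, Fintype.sum_prod_type, Finset.sum_apply]
    exact Finset.sum_congr rfl fun s _ => by rw [blockCount, Finset.card_filter]
  exact ⟨(Equiv.sigmaCongrRight fun k => (Fintype.equivFinOfCardEq (hcard k)).symm).trans
    (Equiv.sigmaFiberEquiv fun p : Fin t × Fin B => d p.1 p.2),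
    fun p => ((Fintype.equivFinOfCardEq (hcard p.1)).symm p.2).2⟩

namespace InfoEnv

variable (E : InfoEnv K)

instance : IsGaussian E.prior := by unfold prior; infer_instance

instance (q : Fin K → ℕ) : IsGaussian (E.sampleLaw q) := by
  have (k : Fin K) := isGaussian_pi fun _ : Fin (q k) => gaussianReal 0 (E.noiseVar k)
  have := isGaussian_pi fun k => Measure.pi fun _ : Fin (q k) => gaussianReal 0 (E.noiseVar k)
  unfold sampleLaw
  infer_instance

instance (B : ℕ) : IsProbabilityMeasure (E.law B) := by unfold law; infer_instance

@[fun_prop]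
lemma measurable_signalMean (k : Fin K) : Measurable fun θ => E.signalMean θ k := by
  unfold signalMean; fun_prop

lemma measurable_sampleObs (q : Fin K → ℕ) : Measurable (E.sampleObs q) := by
  unfold sampleObs; fun_prop

lemma posteriorVar_nonneg [NeZero K] (q : Fin K → ℕ) : 0 ≤ E.posteriorVar q :=
  integral_nonneg_of_ae (condExp_nonneg (ae_of_all _ fun _ => sq_nonneg _))

lemma exists_condGaussian_sampleObs [NeZero K] (q : Fin K → ℕ) :
    ∃ m, CondGaussian (E.sampleLaw q) (E.sampleObs q) (fun ω => ω.1 0) m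
      fun _ => E.posteriorVar q := by
  let curry := MeasurableEquiv.piCurry fun (k : Fin K) (_ : Fin (q k)) => ℝ
  let obs ω := curry.symm (E.sampleObs q ω)
  have hgauss : HasGaussianLaw (fun ω => (obs ω, ω.1 0)) (E.sampleLaw q) := by
    let L : EuclideanSpace ℝ (Fin K) × ((k : Fin K) → Fin (q k) → ℝ) →ₗ[ℝ]
        (((k : Fin K) × Fin (q k)) → ℝ) × ℝ :=
      { toFun ω := (obs ω, ω.1 0)
        map_add' ω ω' := by
          ext <;> simp [obs, curry, sampleObs, signalMean, Sigma.uncurry, mul_add,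
            Finset.sum_add_distrib, add_add_add_comm]
        map_smul' a ω := by
          ext <;> simp [obs, curry, sampleObs, signalMean, Sigma.uncurry, Finset.mul_sum, mul_add,
            mul_left_comm] }
    have hid : HasGaussianLaw (fun ω => ω) (E.sampleLaw q) :=
      ⟨by simpa only [Measure.map_id'] using (inferInstance : IsGaussian (E.sampleLaw q))⟩
    exact hid.map_fun L.toContinuousLinearMap
  obtain ⟨m, w, h⟩ := exists_condGaussian_of_hasGaussianLaw
    (curry.symm.measurable.comp (E.measurable_sampleObs q)) (by fun_prop) hgauss
  have hobs : CondGaussian (E.sampleLaw q) (E.sampleObs q) (fun ω => ω.1 0) _ _ := h.map_equiv curry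
  have hw : E.posteriorVar q = w := hobs.integral_condVar hgauss.snd.integrable
  exact ⟨_, hw ▸ hobs⟩

/-- The observations made according to the schedule `d`: the `b`-th observation of period `s` is
one of source `d s b`. -/
def scheduleObs {t : ℕ} (d : Fin t → Fin B → Fin K)
    (ω : EuclideanSpace ℝ (Fin K) × (ℕ → Fin B → Fin K → ℝ)) : Fin t → Fin B → ℝ :=
  fun s b => E.signalMean ω.1 (d s b) + ω.2 s b (d s b)

lemma measurePreserving_noise {t : ℕ} {q : Fin K → ℕ}
    (σ : ((k : Fin K) × Fin (q k)) ≃ Fin t × Fin B) :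
    MeasurePreserving (fun (ε : ℕ → Fin B → Fin K → ℝ) k j => ε (σ ⟨k, j⟩).1 (σ ⟨k, j⟩).2 k)
      (Measure.infinitePi fun _ => Measure.pi fun _ => Measure.pi fun k =>
        gaussianReal 0 (E.noiseVar k))
      (Measure.pi fun k => Measure.pi fun _ => gaussianReal 0 (E.noiseVar k)) := by
  let N := Measure.pi fun k => gaussianReal 0 (E.noiseVar k)
  have hind := iIndepFun_uncurry_infinitePi' (ι := ℕ) (κ := Fin B)
    (X := fun _ _ (x : Fin K → ℝ) => x) (fun _ _ => N) fun _ _ => measurable_id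
  simp only [Measure.infinitePi_eq_pi] at hind
  have hinj : Function.Injective fun p => (((σ p).1 : ℕ), (σ p).2) :=
    (Function.Injective.prodMap Fin.val_injective Function.injective_id).comp σ.injective
  have hflat := iIndepFun.hasLaw_pi (μ := fun p => gaussianReal 0 (E.noiseVar p.1)) (fun p =>
    ((measurePreserving_eval _ p.1).comp ((measurePreserving_eval (fun _ : Fin B => N) _).comp
      (measurePreserving_eval_infinitePi (fun _ : ℕ => Measure.pi fun _ : Fin B => N) _))).hasLaw)
    ((hind.precomp hinj).comp (fun p x => x p.1) fun p => measurable_pi_apply p.1)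
  have hcurry := Measure.infinitePi_map_piCurry fun (k : Fin K) (_ : Fin (q k)) =>
    gaussianReal 0 (E.noiseVar k)
  simp only [Measure.infinitePi_eq_pi] at hcurry
  exact ⟨by fun_prop, (HasLaw.comp ⟨(MeasurableEquiv.measurable _).aemeasurable, hcurry⟩
    hflat).map_eq⟩

lemma exists_condGaussian_scheduleObs [NeZero K] {t : ℕ} (d : Fin t → Fin B → Fin K) :
    ∃ m, CondGaussian (E.law B) (E.scheduleObs d) (fun ω => ω.1 0) m
      fun _ => E.posteriorVar (∑ s, blockCount (d s)) := by
  set q : Fin K → ℕ := ∑ s, blockCount (d s)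
  obtain ⟨σ, hσ⟩ : ∃ σ : ((k : Fin K) × Fin (q k)) ≃ Fin t × Fin B, ∀ p, d (σ p).1 (σ p).2 = p.1 :=
    exists_equiv_of_schedule d
  let sample (ω : EuclideanSpace ℝ (Fin K) × (ℕ → Fin B → Fin K → ℝ)) :=
    (ω.1, fun k (j : Fin (q k)) => ω.2 (σ ⟨k, j⟩).1 (σ ⟨k, j⟩).2 k)
  have hsample : MeasurePreserving sample (E.law B) (E.sampleLaw q) :=
    (MeasurePreserving.id _).prod (E.measurePreserving_noise σ)
  obtain ⟨m, hm⟩ := E.exists_condGaussian_sampleObs q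
  have hobs := E.measurable_sampleObs q
  have hcond : CondGaussian (E.law B) (fun ω => E.sampleObs q (sample ω)) (fun ω => ω.1 0) m
      fun _ => E.posteriorVar q :=
    hm.of_identDistrib (hobs.comp hsample.measurable) (by fun_prop)
      (identDistrib_comp_of_measurePreserving hsample (X := fun ω => (E.sampleObs q ω, ω.1 0))
        (by fun_prop))
  let e : ((k : Fin K) → Fin (q k) → ℝ) ≃ᵐ (Fin t → Fin B → ℝ) :=
    (MeasurableEquiv.piCurry _).symm.trans
      ((MeasurableEquiv.piCongrLeft (fun _ => ℝ) σ).trans (MeasurableEquiv.curry _ _ _))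
  have he ω : e (E.sampleObs q (sample ω)) = E.scheduleObs d ω := by
    refine (e.symm_apply_eq.1 ?_).symm
    ext k j
    change E.signalMean ω.1 (d (σ ⟨k, j⟩).1 (σ ⟨k, j⟩).2) +
      ω.2 (σ ⟨k, j⟩).1 (σ ⟨k, j⟩).2 (d (σ ⟨k, j⟩).1 (σ ⟨k, j⟩).2) = _
    rw [hσ]
    rfl
  have := hcond.map_equiv e
  simp only [he] at this
  exact ⟨_, this⟩

end InfoEnv

namespace AcqStrategy

variable (S : AcqStrategy K B)

/-- The schedule of sources that a strategy prescribes along a history. -/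
def path {t : ℕ} (h : Fin t → Fin B → ℝ) : Fin t → Fin B → Fin K :=
  fun s => S.choose s fun i => h (Fin.castLE s.isLt.le i)

lemma measurable_path (t : ℕ) : Measurable (S.path (t := t)) :=
  measurable_pi_lambda _ fun s => (S.measurable_choose s).comp (by fun_prop)

lemma division_eq_sum_path {t : ℕ} (h : Fin t → Fin B → ℝ) :
    S.division t h = ∑ s, blockCount (S.path h s) := by
  ext k
  simp only [division, Finset.sum_apply]
  rfl

lemma path_succ {t : ℕ} (h : Fin (t + 1) → Fin B → ℝ) :
    S.path h = Fin.snoc (α := fun _ => Fin B → Fin K) (S.path (Fin.init h))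
      (S.choose t (Fin.init h)) := by
  refine (Fin.snoc_init_self (α := fun _ => Fin B → Fin K) _).symm.trans ?_
  rfl

end AcqStrategy

lemma measurable_fin_snoc {β α : Type*} [MeasurableSpace β] [MeasurableSpace α] {n : ℕ}
    {f : β → Fin n → α} {g : β → α} (hf : Measurable f) (hg : Measurable g) :
    Measurable fun b => Fin.snoc (α := fun _ => α) (f b) (g b) := by
  refine measurable_pi_lambda _ (Fin.lastCases ?_ fun i => ?_)
  · simpa only [Fin.snoc_last]
  · simpa only [Fin.snoc_castSucc] using! (measurable_pi_apply i).comp hf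

namespace InfoEnv

variable (E : InfoEnv K) (S : AcqStrategy K B)

lemma init_history (ω) (t : ℕ) : Fin.init (E.history S ω (t + 1)) = E.history S ω t :=
  Fin.init_snoc (α := fun _ => Fin B → ℝ) ..

@[fun_prop]
lemma measurable_history (t : ℕ) : Measurable fun ω => E.history S ω t := by
  induction t with
  | zero => exact measurable_of_subsingleton_codomain _
  | succ t ih =>
    refine measurable_fin_snoc ih (measurable_pi_lambda _ fun b => ?_)
    have hobs : Measurable fun p : Fin K × EuclideanSpace ℝ (Fin K) × (ℕ → Fin B → Fin K → ℝ) =>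
        E.signalMean p.2.1 p.1 + p.2.2 t b p.1 :=
      measurable_from_prod_countable_right fun k => by
        simp only
        fun_prop
    have hsource : Measurable fun ω => S.choose t (E.history S ω t) b :=
      (measurable_pi_apply b).comp ((S.measurable_choose t).comp ih)
    exact hobs.comp (hsource.prodMk measurable_id)

lemma history_eq_scheduleObs {t : ℕ} (d : Fin t → Fin B → Fin K) (ω)
    (hd : S.path (E.history S ω t) = d ∨ S.path (E.scheduleObs d ω) = d) :
    E.history S ω t = E.scheduleObs d ω := by
  induction t with
  | zero => exact Subsingleton.elim _ _
  | succ t ih =>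
    obtain ⟨d, s, rfl⟩ : ∃ d' s, d = Fin.snoc (α := fun _ => Fin B → Fin K) d' s :=
      ⟨_, _, (Fin.snoc_init_self _).symm⟩
    have hinit : Fin.init (E.scheduleObs (Fin.snoc d s) ω) = E.scheduleObs d ω := by
      ext i b
      simp [Fin.init, scheduleObs]
    simp only [AcqStrategy.path_succ, init_history, hinit, Fin.snoc_inj] at hd
    have ht := ih d (hd.imp And.left And.left)
    have hs : S.choose t (E.history S ω t) = s := hd.elim And.right fun h => ht ▸ h.2
    rw [history, hs, ht, ← hinit]
    refine Eq.trans ?_ (Fin.snoc_init_self (α := fun _ => Fin B → ℝ) _)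
    congr 1
    ext b
    simp [scheduleObs]

lemma exists_condGaussian_history [NeZero K] (t : ℕ) :
    ∃ m, CondGaussian (E.law B) (fun ω => E.history S ω t) (fun ω => ω.1 0) m
      fun h => E.posteriorVar (S.division t h) := by
  choose m hm using E.exists_condGaussian_scheduleObs (B := B) (t := t)
  have h := condGaussian_of_partition (S.measurable_path t) (E.measurable_history S t)
    (by fun_prop) hm (E.history_eq_scheduleObs S)
  simp only [← AcqStrategy.division_eq_sum_path] at h
  exact ⟨_, h⟩

end InfoEnv

/-! ### Garbling a more informative experiment -/

section Laws

variable {Ω Ω' α β δ : Type*} [MeasurableSpace Ω] [MeasurableSpace Ω'] [MeasurableSpace α]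
  [MeasurableSpace β] [MeasurableSpace δ] {P : Measure Ω} {P' : Measure Ω'}

lemma identDistrib_prodMk_iff_forall_restrict [IsFiniteMeasure P] {X : Ω → α} {X' : Ω' → α}
    {Y : Ω → β} {Y' : Ω' → β} (hX : Measurable X) (hX' : Measurable X') (hY : Measurable Y)
    (hY' : Measurable Y') :
    IdentDistrib (fun ω => (X ω, Y ω)) (fun ω => (X' ω, Y' ω)) P P' ↔
      ∀ A, MeasurableSet A →
        (P.restrict (X ⁻¹' A)).map Y = (P'.restrict (X' ⁻¹' A)).map Y' := by
  have hslice {A : Set α} {C : Set β} (hC : MeasurableSet C) :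
      (P.restrict (X ⁻¹' A)).map Y C = P ((fun ω => (X ω, Y ω)) ⁻¹' A ×ˢ C) ∧
        (P'.restrict (X' ⁻¹' A)).map Y' C = P' ((fun ω => (X' ω, Y' ω)) ⁻¹' A ×ˢ C) := by
    rw [Measure.map_apply hY hC, Measure.map_apply hY' hC, Measure.restrict_apply (hY hC),
      Measure.restrict_apply (hY' hC), Set.mk_preimage_prod, Set.mk_preimage_prod,
      Set.inter_comm, Set.inter_comm (Y' ⁻¹' C)]
    exact ⟨rfl, rfl⟩
  refine ⟨fun h A hA => ?_, fun h => ⟨by fun_prop, by fun_prop, ?_⟩⟩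
  · ext C hC
    rw [(hslice hC).1, (hslice hC).2, h.measure_mem_eq (hA.prod hC)]
  · refine Measure.ext_prod_iff.2 fun {A C} hA hC => ?_
    rw [Measure.map_apply (by fun_prop) (hA.prod hC), Measure.map_apply (by fun_prop) (hA.prod hC),
      ← (hslice hC).1, ← (hslice hC).2, h A hA]

lemma map_prod_eq_compProd {F : α → β → δ} (hF : Measurable (Function.uncurry F))
    (μ : Measure α) [SFinite μ] (ν : Measure β) [SFinite ν] {κ : Kernel α δ} [IsSFiniteKernel κ]
    (h : ∀ x, ν.map (F x) = κ x) :
    (μ.prod ν).map (fun p => (p.1, F p.1 p.2)) = μ ⊗ₘ κ := by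
  have hF' : Measurable fun p : α × β => (p.1, F p.1 p.2) := measurable_fst.prodMk hF
  ext s hs
  rw [Measure.map_apply hF' hs, Measure.prod_apply (hF' hs), Measure.compProd_apply hs]
  refine lintegral_congr fun x => ?_
  rw [← h x, Measure.map_apply hF.of_uncurry_left (measurable_prodMk_left hs)]
  rfl

lemma identDistrib_prod_of_forall {γ : Type*} [MeasurableSpace γ] {F : α → β → δ} {G : α → γ → δ}
    (hF : Measurable (Function.uncurry F)) (hG : Measurable (Function.uncurry G)) (μ : Measure α)
    [SFinite μ] {ν : Measure β} {ρ : Measure γ} [SFinite ν] [SFinite ρ]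
    (h : ∀ x, IdentDistrib (F x) (G x) ν ρ) :
    IdentDistrib (fun p => (p.1, F p.1 p.2)) (fun p => (p.1, G p.1 p.2)) (μ.prod ν)
      (μ.prod ρ) where
  aemeasurable_fst := (measurable_fst.prodMk hF).aemeasurable
  aemeasurable_snd := (measurable_fst.prodMk hG).aemeasurable
  map_eq := by
    let κ : Kernel α δ := (Kernel.id ×ₖ Kernel.const α ρ).map (Function.uncurry G)
    have hκ x : ρ.map (G x) = κ x := by
      rw [Kernel.map_apply _ hG, Kernel.prod_apply, Kernel.id_apply, Kernel.const_apply,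
        Measure.dirac_prod, Measure.map_map hG measurable_prodMk_left]
      rfl
    rw [map_prod_eq_compProd hF μ ν fun x => (h x).map_eq.trans (hκ x),
      map_prod_eq_compProd hG μ ρ hκ]

/-- Noise outsourcing: `E` is redrawn from `X` and an independent uniform variable by the quantile
transform of its conditional law. -/
lemma exists_identDistrib_of_uniform [IsFiniteMeasure P] [StandardBorelSpace β] [Nonempty β]
    {X : Ω → α} {E : Ω → β} (hX : Measurable X) (hE : Measurable E) :
    ∃ f : α → unitInterval → β, Measurable (Function.uncurry f) ∧
      ∀ {Ω' : Type _} [MeasurableSpace Ω'] (P' : Measure Ω') [SFinite P'] (X' : Ω' → α),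
        Measurable X' → IdentDistrib X' X P' P →
        IdentDistrib (fun p => (X' p.1, f (X' p.1) p.2)) (fun ω => (X ω, E ω)) (P'.prod volume)
          P := by
  obtain ⟨f, hf, hfκ⟩ := (condDistrib E X P).exists_measurable_map_eq_unitInterval
  refine ⟨f, hf, fun P' _ X' hX' h => ?_⟩
  have hredraw : IdentDistrib (fun p : Ω × unitInterval => (X p.1, f (X p.1) p.2))
      (fun ω => (X ω, E ω)) (P.prod volume) P := by
    refine ⟨by fun_prop, by fun_prop, ?_⟩
    rw [← compProd_map_condDistrib hE.aemeasurable, ← map_prod_eq_compProd hf _ _ hfκ]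
    have hprod := Measure.map_prod_map P (volume : Measure unitInterval) hX measurable_id
    rw [Measure.map_id] at hprod
    rw [hprod, Measure.map_map (by fun_prop) (by fun_prop)]
    rfl
  exact ((identDistrib_prod_right hX' hX h volume).comp
    (u := fun q => (q.1, f q.1 q.2)) (by fun_prop)).trans hredraw

end Laws

section Deconvolution

lemma eq_of_conv_gaussianReal_eq {μ ν : Measure ℝ} [IsFiniteMeasure μ] [IsFiniteMeasure ν]
    {m : ℝ} {v : ℝ≥0} (h : μ ∗ gaussianReal m v = ν ∗ gaussianReal m v) : μ = ν := by
  refine Measure.ext_of_charFun (funext fun t => ?_)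
  have hchar := congrArg (fun ρ => charFun ρ t) h
  simp only [charFun_conv] at hchar
  refine mul_right_cancel₀ ?_ hchar
  rw [charFun_gaussianReal]
  exact Complex.exp_ne_zero _

variable {Ω Ω' α : Type*} [MeasurableSpace Ω] [MeasurableSpace Ω'] [MeasurableSpace α]
  {P : Measure Ω} {P' : Measure Ω'}

lemma map_restrict_add_mul_gaussian [IsFiniteMeasure P] {N : Ω → ℝ} (hN : Measurable N)
    (S : Set Ω) (s : ℝ) :
    (((P.prod (gaussianReal 0 1)).restrict (Prod.fst ⁻¹' S)).map fun p => N p.1 + s * p.2) =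
      (P.restrict S).map N ∗ (gaussianReal 0 1).map (s * ·) := by
  rw [Measure.conv, Measure.map_prod_map _ _ hN (by fun_prop),
    Measure.map_map (by fun_prop) (by fun_prop), ← Set.prod_univ, ← Measure.prod_restrict,
    Measure.restrict_univ]
  rfl

lemma identDistrib_of_add_mul_gaussian [IsFiniteMeasure P] [IsFiniteMeasure P'] {X : Ω → α}
    {X' : Ω' → α} {N : Ω → ℝ} {N' : Ω' → ℝ} (hX : Measurable X) (hX' : Measurable X')
    (hN : Measurable N) (hN' : Measurable N') {s : ℝ}
    (h : IdentDistrib (fun p : Ω × ℝ => (X p.1, N p.1 + s * p.2))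
      (fun p : Ω' × ℝ => (X' p.1, N' p.1 + s * p.2)) (P.prod (gaussianReal 0 1))
      (P'.prod (gaussianReal 0 1))) :
    IdentDistrib (fun ω => (X ω, N ω)) (fun ω => (X' ω, N' ω)) P P' := by
  rw [identDistrib_prodMk_iff_forall_restrict hX hX' hN hN']
  intro A hA
  have hconv := (identDistrib_prodMk_iff_forall_restrict (hX.comp measurable_fst)
    (hX'.comp measurable_fst) (by fun_prop) (by fun_prop)).1 h A hA
  simp only [Set.preimage_comp, map_restrict_add_mul_gaussian hN,
    map_restrict_add_mul_gaussian hN', gaussianReal_map_const_mul] at hconv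
  exact eq_of_conv_gaussianReal_eq hconv

end Deconvolution

lemma identDistrib_mul_add_mul_gaussian (a b : ℝ) :
    IdentDistrib (fun p : ℝ × ℝ => a * p.1 + b * p.2) (fun z => √(a ^ 2 + b ^ 2) * z)
      ((gaussianReal 0 1).prod (gaussianReal 0 1)) (gaussianReal 0 1) where
  aemeasurable_fst := by fun_prop
  aemeasurable_snd := by fun_prop
  map_eq := by
    have hconv : ((gaussianReal 0 1).prod (gaussianReal 0 1)).map (fun p => a * p.1 + b * p.2) =
        (gaussianReal 0 1).map (a * ·) ∗ (gaussianReal 0 1).map (b * ·) := by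
      rw [Measure.conv, Measure.map_prod_map _ _ (by fun_prop) (by fun_prop),
        Measure.map_map (by fun_prop) (by fun_prop)]
      rfl
    rw [hconv, gaussianReal_map_const_mul, gaussianReal_map_const_mul,
      gaussianReal_conv_gaussianReal, gaussianReal_map_const_mul]
    congr 1
    · simp
    · ext
      simp [Real.sq_sqrt (add_nonneg (sq_nonneg a) (sq_nonneg b))]

lemma measurePreserving_prod_right_comm {α β γ : Type*} [MeasurableSpace α] [MeasurableSpace β]
    [MeasurableSpace γ] (μ : Measure α) (ν : Measure β) (ρ : Measure γ) [SFinite μ] [SFinite ν]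
    [SFinite ρ] :
    MeasurePreserving (fun p : (α × β) × γ => ((p.1.1, p.2), p.1.2)) ((μ.prod ν).prod ρ)
      ((μ.prod ρ).prod ν) :=
  ((measurePreserving_prodAssoc μ ρ ν).symm.comp
    ((MeasurePreserving.id μ).prod Measure.measurePreserving_swap)).comp
      (measurePreserving_prodAssoc μ ν ρ)

namespace CondGaussian

variable {Ω α : Type*} [MeasurableSpace Ω] [MeasurableSpace α] {P : Measure Ω} {X : Ω → α}
  {Y : Ω → ℝ} {m v : α → ℝ} {w : ℝ}

lemma identDistrib_add_add [SFinite P] (h : CondGaussian P X Y m v) (hw : 0 ≤ w)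
    (hwv : ∀ x, w ≤ v x) :
    IdentDistrib (fun ω => (X ω, Y ω))
      (fun p : (Ω × ℝ) × ℝ =>
        (X p.1.1, m (X p.1.1) + √(v (X p.1.1) - w) * p.1.2 + √w * p.2)) P
      ((P.prod (gaussianReal 0 1)).prod (gaussianReal 0 1)) := by
  have hX := h.measurable_obs
  have hm := h.measurable_mean
  have hv := h.measurable_var
  have hsplit := identDistrib_prod_of_forall (δ := ℝ)
    (F := fun ω (z : ℝ) => √(v (X ω)) * z)
    (G := fun ω (z : ℝ × ℝ) => √(v (X ω) - w) * z.1 + √w * z.2)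
    (by fun_prop) (by fun_prop) P fun ω => by
      simpa only [Real.sq_sqrt (sub_nonneg.2 (hwv (X ω))), Real.sq_sqrt hw, sub_add_cancel] using
        (identDistrib_mul_add_mul_gaussian √(v (X ω) - w) √w).symm
  have hadd := hsplit.comp (u := fun q => (X q.1, m (X q.1) + q.2)) (by fun_prop)
  have hregroup := identDistrib_comp_of_measurePreserving
    (measurePreserving_prodAssoc P (gaussianReal 0 1) (gaussianReal 0 1))
    (X := fun p => (X p.1, m (X p.1) + (√(v (X p.1) - w) * p.2.1 + √w * p.2.2))) (by fun_prop)
  simp only [add_assoc]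
  exact h.identDistrib.trans (hadd.trans hregroup.symm)

/-- With a constant conditional variance, the observation enters the conditional law only through
the mean, so any randomization of it may replace it. -/
lemma randomize {R δ : Type*} [MeasurableSpace R] [MeasurableSpace δ] [SFinite P]
    (h : CondGaussian P X Y m fun _ => w) (ρ : Measure R) [IsProbabilityMeasure ρ]
    {g : α × R → δ} (hg : Measurable g) :
    CondGaussian (P.prod ρ) (fun p => (g (X p.1, p.2), m (X p.1))) (fun p => Y p.1) Prod.snd
      fun _ => w where
  measurable_obs := by
    have := h.measurable_obs
    have := h.measurable_mean
    fun_prop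
  measurable_target := h.measurable_target.comp measurable_fst
  measurable_mean := measurable_snd
  measurable_var := measurable_const
  identDistrib := by
    have hX := h.measurable_obs
    have hY := h.measurable_target
    have hm := h.measurable_mean
    have hR := (identDistrib_prod_right (by fun_prop) (by fun_prop) h.identDistrib ρ).comp
      (u := fun q => ((g (q.1.1, q.2), m q.1.1), q.1.2)) (by fun_prop)
    exact hR.trans (identDistrib_comp_of_measurePreserving
      (measurePreserving_prod_right_comm P (gaussianReal 0 1) ρ)
      (X := fun p => ((g (X p.1.1, p.1.2), m (X p.1.1)), m (X p.1.1) + √w * p.2)) (by fun_prop))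

end CondGaussian

section Simulation

variable {Ω α β : Type*} [MeasurableSpace Ω] [MeasurableSpace α] [MeasurableSpace β]
  {P : Measure Ω} [IsFiniteMeasure P]

lemma CondGaussian.identDistrib_garbled_mean {Ω' : Type*} [MeasurableSpace Ω'] {Q : Measure Ω'}
    [IsFiniteMeasure Q] {X : Ω → α} {X' : Ω' → α} {E : Ω → β} {Y : Ω → ℝ} {N Y' : Ω' → ℝ}
    {m v : α × β → ℝ} {w : ℝ} (h : CondGaussian P (fun ω => (X ω, E ω)) Y m v)
    (h' : CondGaussian Q (fun ω => (X' ω, N ω)) Y' Prod.snd fun _ => w) (hw : 0 ≤ w)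
    (hwv : ∀ x, w ≤ v x)
    (hXY : IdentDistrib (fun ω => (X' ω, Y' ω)) (fun ω => (X ω, Y ω)) Q P) :
    IdentDistrib (fun ω => (X' ω, N ω))
      (fun p : Ω × ℝ => (X p.1, m (X p.1, E p.1) + √(v (X p.1, E p.1) - w) * p.2)) Q
      (P.prod (gaussianReal 0 1)) := by
  have hX : Measurable X := h.measurable_obs.fst
  have hE : Measurable E := h.measurable_obs.snd
  have hm := h.measurable_mean
  have hv := h.measurable_var
  have hnoise := (h.identDistrib_add_add hw hwv).comp (u := fun q => (q.1.1, q.2)) (by fun_prop)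
  have hnoise' := h'.identDistrib.comp (u := fun q => (q.1.1, q.2)) (by fun_prop)
  exact identDistrib_of_add_mul_gaussian h'.measurable_obs.fst (by fun_prop)
    h'.measurable_obs.snd (by fun_prop)
    (hnoise'.symm.trans (hXY.trans hnoise))

/-- Blackwell: a signal `E` is redrawn from the past and the posterior mean `N` of an experiment
with a smaller posterior variance. -/
lemma CondGaussian.exists_garbling [StandardBorelSpace β] [Nonempty β] {X : Ω → α} {E : Ω → β}
    {Y : Ω → ℝ} {m v : α × β → ℝ} (h : CondGaussian P (fun ω => (X ω, E ω)) Y m v) {w : ℝ}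
    (hw : 0 ≤ w) (hwv : ∀ x, w ≤ v x) :
    ∃ f : α × ℝ → unitInterval → β, Measurable (Function.uncurry f) ∧
      ∀ {Ω' : Type _} [MeasurableSpace Ω'] (Q : Measure Ω') [IsFiniteMeasure Q]
        (X' : Ω' → α) (N Y' : Ω' → ℝ),
        IdentDistrib (fun ω => (X' ω, Y' ω)) (fun ω => (X ω, Y ω)) Q P →
        CondGaussian Q (fun ω => (X' ω, N ω)) Y' Prod.snd (fun _ => w) →
        IdentDistrib (fun p => ((X' p.1, f (X' p.1, N p.1) p.2), Y' p.1))
          (fun ω => ((X ω, E ω), Y ω)) (Q.prod volume) P := by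
  have hX : Measurable X := h.measurable_obs.fst
  have hE : Measurable E := h.measurable_obs.snd
  have hm := h.measurable_mean
  have hv := h.measurable_var
  let N' : Ω × ℝ → ℝ := fun p => m (X p.1, E p.1) + √(v (X p.1, E p.1) - w) * p.2
  have hN' : Measurable N' := by fun_prop
  obtain ⟨f, hf, hredraw⟩ := exists_identDistrib_of_uniform (P := P.prod (gaussianReal 0 1))
    (X := fun p => (X p.1, N' p)) (E := fun p => E p.1) (by fun_prop) (by fun_prop)
  refine ⟨f, hf, fun {Ω'} _ Q _ X' N Y' hXY h' => ?_⟩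
  have hX' : Measurable X' := h'.measurable_obs.fst
  have hN : Measurable N := h'.measurable_obs.snd
  have hf' : Measurable fun q : (α × ℝ) × unitInterval => f q.1 q.2 := hf
  have hsignal := identDistrib_prod_right (by fun_prop) (by fun_prop)
    (hredraw Q _ h'.measurable_obs (h.identDistrib_garbled_mean h' hw hwv hXY)) (gaussianReal 0 1)
  have htarget := (h'.randomize (volume : Measure unitInterval)
    (g := fun q => (q.1.1, f q.1 q.2)) (by fun_prop)).identDistrib
  have htarget' := htarget.comp (u := fun q => (q.1.1, q.2)) (by fun_prop)
  have hsignal' := hsignal.comp (u := fun q => ((q.1.1.1, q.1.2), q.1.1.2 + √w * q.2))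
    (by fun_prop)
  exact htarget'.trans (hsignal'.trans (h.identDistrib_add_add hw hwv).symm)

end Simulation

/-- The splitting of a finite sequence into its initial part and its last entry. -/
def finInitLastEquiv (α : Type*) [MeasurableSpace α] (t : ℕ) :
    (Fin (t + 1) → α) ≃ᵐ (Fin t → α) × α where
  toFun x := (Fin.init x, x (Fin.last t))
  invFun p := Fin.snoc (α := fun _ => α) p.1 p.2
  left_inv x := Fin.snoc_init_self x
  right_inv p := by simp
  measurable_toFun := by
    simp only [Equiv.coe_fn_mk, Fin.init_def]
    fun_prop
  measurable_invFun := measurable_fin_snoc measurable_fst measurable_snd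

lemma measurable_fin_init {α : Type*} [MeasurableSpace α] {t : ℕ} :
    Measurable fun x : Fin (t + 1) → α => (Fin.init x : Fin t → α) :=
  (finInitLastEquiv α t).measurable.fst

lemma measurePreserving_finInitLastEquiv {α : Type*} [MeasurableSpace α] (μ : Measure α)
    [SigmaFinite μ] (t : ℕ) :
    MeasurePreserving (finInitLastEquiv α t) (Measure.pi fun _ => μ)
      ((Measure.pi fun _ => μ).prod μ) := by
  convert Measure.measurePreserving_swap.comp
    (measurePreserving_piFinSuccAbove (fun _ => μ) (Fin.last t)) using 1
  ext x i <;> simp [finInitLastEquiv, MeasurableEquiv.piFinSuccAbove, Fin.init]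

section Simulation

variable {α β R : Type*}

/-- The history simulated from the history `x` of another experiment: its entry in period `t` is
drawn by `f t` from the simulated past, the posterior mean `m (t + 1)` given `x`, and fresh
randomness `r t`. -/
def simulate (f : (t : ℕ) → (Fin t → β) × ℝ → R → β) (m : (t : ℕ) → (Fin t → α) → ℝ) :
    (t : ℕ) → (Fin t → R) → (Fin t → α) → Fin t → β
  | 0, _, _ => Fin.elim0
  | t + 1, r, x =>
    Fin.snoc (α := fun _ => β) (simulate f m t (Fin.init r) (Fin.init x))
      (f t (simulate f m t (Fin.init r) (Fin.init x), m (t + 1) x) (r (Fin.last t)))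

variable {f : (t : ℕ) → (Fin t → β) × ℝ → R → β} {m : (t : ℕ) → (Fin t → α) → ℝ}

lemma init_simulate (t : ℕ) (r : Fin (t + 1) → R) (x : Fin (t + 1) → α) :
    Fin.init (simulate f m (t + 1) r x) = simulate f m t (Fin.init r) (Fin.init x) :=
  Fin.init_snoc (α := fun _ => β) ..

variable [MeasurableSpace α] [MeasurableSpace β] [MeasurableSpace R]

lemma measurable_simulate (hf : ∀ t, Measurable (Function.uncurry (f t)))
    (hm : ∀ t, Measurable (m t)) (t : ℕ) :
    Measurable fun p : (Fin t → R) × (Fin t → α) => simulate f m t p.1 p.2 := by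
  induction t with
  | zero => exact measurable_of_subsingleton_codomain _
  | succ t ih =>
    have hpast : Measurable fun p : (Fin (t + 1) → R) × (Fin (t + 1) → α) =>
        simulate f m t (Fin.init p.1) (Fin.init p.2) :=
      ih.comp (measurable_fin_init.prodMap measurable_fin_init)
    exact measurable_fin_snoc hpast
      ((hf t).comp ((hpast.prodMk ((hm (t + 1)).comp measurable_snd)).prodMk (by fun_prop)))

variable {Ω : Type*} [MeasurableSpace Ω] {P : Measure Ω} [IsFiniteMeasure P] {Y : Ω → ℝ}
  {h : (t : ℕ) → Ω → Fin t → α}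

lemma condGaussian_simulate {ρ : Measure R} [IsProbabilityMeasure ρ]
    (hinit : ∀ t ω, Fin.init (h (t + 1) ω) = h t ω) {w : ℕ → ℝ}
    (hcond : ∀ t, CondGaussian P (h t) Y (m t) fun _ => w t)
    (hf : ∀ t, Measurable (Function.uncurry (f t))) (t : ℕ) :
    CondGaussian (P.prod (Measure.pi fun _ : Fin t => ρ))
      (fun p => (simulate f m t p.2 (h t p.1), m (t + 1) (h (t + 1) p.1))) (fun p => Y p.1)
      Prod.snd fun _ => w (t + 1) := by
  have hg : Measurable fun q : (Fin (t + 1) → α) × (Fin t → R) =>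
      simulate f m t q.2 (Fin.init q.1) :=
    (measurable_simulate hf (fun t => (hcond t).measurable_mean) t).comp
      (measurable_snd.prodMk (measurable_fin_init.comp measurable_fst))
  simpa only [hinit] using (hcond (t + 1)).randomize (Measure.pi fun _ : Fin t => ρ) hg

lemma exists_simulation [StandardBorelSpace β] [Nonempty β]
    {h' : (t : ℕ) → Ω → Fin t → β} (hinit : ∀ t ω, Fin.init (h (t + 1) ω) = h t ω)
    (hinit' : ∀ t ω, Fin.init (h' (t + 1) ω) = h' t ω) {w : ℕ → ℝ}
    {m' v' : (t : ℕ) → (Fin t → β) → ℝ}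
    (hcond : ∀ t, CondGaussian P (h t) Y (m t) fun _ => w t)
    (hcond' : ∀ t, CondGaussian P (h' t) Y (m' t) (v' t)) (hw : ∀ t, 0 ≤ w t)
    (hwv : ∀ t x, w t ≤ v' t x) :
    ∃ f : (t : ℕ) → (Fin t → β) × ℝ → unitInterval → β,
      (∀ t, Measurable (Function.uncurry (f t))) ∧
      ∀ t, IdentDistrib (fun p => (simulate f m t p.2 (h t p.1), Y p.1)) (fun ω => (h' t ω, Y ω))
        (P.prod (Measure.pi fun _ => volume)) P := by
  have hsplit : ∀ t, CondGaussian P (fun ω => (h' t ω, h' (t + 1) ω (Fin.last t))) Y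
      (fun p => m' (t + 1) ((finInitLastEquiv β t).symm p))
      (fun p => v' (t + 1) ((finInitLastEquiv β t).symm p)) := fun t => by
    have := (hcond' (t + 1)).map_equiv (finInitLastEquiv β t)
    simp only [finInitLastEquiv, hinit', MeasurableEquiv.coe_mk, Equiv.coe_fn_mk] at this
    exact this
  choose f hf hgarble using fun t => (hsplit t).exists_garbling (hw (t + 1)) fun _ => hwv _ _
  refine ⟨f, hf, fun t => ?_⟩
  induction t with
  | zero =>
    have hX := ((hcond' 0).measurable_obs.prodMk (hcond' 0).measurable_target).aemeasurable (μ := P)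
    convert! identDistrib_comp_of_measurePreserving (measurePreserving_fst (μ := P)
      (ν := Measure.pi fun _ : Fin 0 => (volume : Measure unitInterval))) hX using 4
  | succ t ih =>
    have hdrawn := (hgarble t _ _ _ _ ih (condGaussian_simulate hinit hcond hf t)).comp
      (u := fun q => ((finInitLastEquiv β t).symm q.1, q.2)) (by fun_prop)
    have hpres := (measurePreserving_prodAssoc P (Measure.pi fun _ => volume) volume).symm.comp
      ((MeasurePreserving.id P).prod
        (measurePreserving_finInitLastEquiv (volume : Measure unitInterval) t))
    have hsim := (identDistrib_comp_of_measurePreserving hpres hdrawn.aemeasurable_fst).trans hdrawn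
    convert! hsim using 3 with p ω
    · rw [simulate, hinit]
      rfl
    · refine (Fin.snoc_init_self (h' (t + 1) ω)).symm.trans ?_
      rw [hinit' t]
      rfl

end Simulation

section Sequence

variable {Ω Ω' : Type*} [MeasurableSpace Ω] [MeasurableSpace Ω'] {P : Measure Ω} {P' : Measure Ω'}
  [IsFiniteMeasure P]

lemma identDistrib_pi_of_forall_of_map_le {𝓧 : ℕ → Type*} [∀ t, MeasurableSpace (𝓧 t)]
    {π : {s t : ℕ} → s ≤ t → 𝓧 t → 𝓧 s} (hπ : ∀ {s t : ℕ} (hst : s ≤ t), Measurable (π hst))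
    {X : (t : ℕ) → Ω → 𝓧 t} {X' : (t : ℕ) → Ω' → 𝓧 t} (hX : ∀ t, Measurable (X t))
    (hX' : ∀ t, Measurable (X' t)) (hXπ : ∀ {s t : ℕ} (hst : s ≤ t) ω, π hst (X t ω) = X s ω)
    (hXπ' : ∀ {s t : ℕ} (hst : s ≤ t) ω, π hst (X' t ω) = X' s ω)
    (h : ∀ t, IdentDistrib (X t) (X' t) P P') :
    IdentDistrib (fun ω t => X t ω) (fun ω t => X' t ω) P P' where
  aemeasurable_fst := by fun_prop
  aemeasurable_snd := by fun_prop
  map_eq := by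
    refine (isProjectiveLimit_map (by fun_prop)).unique fun I => ?_
    have hle (i : I) : (i : ℕ) ≤ I.sup id := Finset.le_sup (f := id) i.2
    have hI := (h (I.sup id)).comp (u := fun x (i : I) => π (hle i) x) (by fun_prop)
    simp only [Function.comp_def, hXπ, hXπ'] at hI
    exact (isProjectiveLimit_map (by fun_prop) I).trans hI.map_eq.symm

lemma castLE_comp_of_init {α : Type*} {x : (t : ℕ) → Fin t → α}
    (hinit : ∀ t, Fin.init (x (t + 1)) = x t) {s t : ℕ} (hst : s ≤ t) :
    (fun i => x t (Fin.castLE hst i)) = x s := by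
  induction t, hst using Nat.le_induction with
  | base => rfl
  | succ t hst ih =>
    rw [← ih, ← hinit t]
    rfl

lemma identDistrib_histories {α β : Type*} [MeasurableSpace α] [MeasurableSpace β]
    {Y : Ω → β} {Y' : Ω' → β} {h : (t : ℕ) → Ω → Fin t → α} {h' : (t : ℕ) → Ω' → Fin t → α}
    (hY : Measurable Y) (hY' : Measurable Y') (hh : ∀ t, Measurable (h t))
    (hh' : ∀ t, Measurable (h' t)) (hinit : ∀ t ω, Fin.init (h (t + 1) ω) = h t ω)
    (hinit' : ∀ t ω, Fin.init (h' (t + 1) ω) = h' t ω)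
    (heq : ∀ t, IdentDistrib (fun ω => (h t ω, Y ω)) (fun ω => (h' t ω, Y' ω)) P P') :
    IdentDistrib (fun ω => ((fun t => h t ω), Y ω)) (fun ω => ((fun t => h' t ω), Y' ω)) P P' := by
  have hjoint := identDistrib_pi_of_forall_of_map_le
    (π := fun hst (p : (Fin _ → α) × β) => ((fun i => p.1 (Fin.castLE hst i)), p.2))
    (fun _ => by fun_prop) (fun t => (hh t).prodMk hY) (fun t => (hh' t).prodMk hY')
    (fun hst ω => by rw [castLE_comp_of_init (x := fun t => h t ω) (hinit · ω)])
    (fun hst ω => by rw [castLE_comp_of_init (x := fun t => h' t ω) (hinit' · ω)]) heq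
  exact hjoint.comp (u := fun x => ((fun t => (x t).1), (x 0).2)) (by fun_prop)

end Sequence

lemma exists_simulation_sequence {Ω α β : Type*} [MeasurableSpace Ω] [MeasurableSpace α]
    [MeasurableSpace β] [StandardBorelSpace β] [Nonempty β] {P : Measure Ω} [IsFiniteMeasure P]
    {Y : Ω → ℝ} {h : (t : ℕ) → Ω → Fin t → α} {h' : (t : ℕ) → Ω → Fin t → β}
    (hinit : ∀ t ω, Fin.init (h (t + 1) ω) = h t ω)
    (hinit' : ∀ t ω, Fin.init (h' (t + 1) ω) = h' t ω) {w : ℕ → ℝ}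
    {m : (t : ℕ) → (Fin t → α) → ℝ} {m' v' : (t : ℕ) → (Fin t → β) → ℝ}
    (hcond : ∀ t, CondGaussian P (h t) Y (m t) fun _ => w t)
    (hcond' : ∀ t, CondGaussian P (h' t) Y (m' t) (v' t)) (hw : ∀ t, 0 ≤ w t)
    (hwv : ∀ t x, w t ≤ v' t x) :
    ∃ Φ : (t : ℕ) → (ℕ → unitInterval) → (Fin t → α) → Fin t → β,
      (∀ t, Measurable (Function.uncurry (Φ t))) ∧
      IdentDistrib (fun p => ((fun t => Φ t p.2 (h t p.1)), Y p.1))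
        (fun ω => ((fun t => h' t ω), Y ω)) (P.prod (Measure.infinitePi fun _ => volume)) P := by
  obtain ⟨f, hf, hlaw⟩ := exists_simulation hinit hinit' hcond hcond' hw hwv
  let Φ (t : ℕ) (r : ℕ → unitInterval) (x : Fin t → α) : Fin t → β :=
    simulate f m t (fun i => r i) x
  have hΦ (t : ℕ) : Measurable (Function.uncurry (Φ t)) := by
    have := measurable_simulate hf (fun t => (hcond t).measurable_mean) t
    exact this.comp (by fun_prop : Measurable fun p : (ℕ → unitInterval) × (Fin t → α) =>
      ((fun i : Fin t => p.1 i), p.2))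
  have hY := (hcond 0).measurable_target
  refine ⟨Φ, hΦ, identDistrib_histories (by fun_prop) hY
    (fun t => (hΦ t).comp
      (measurable_snd.prodMk ((hcond t).measurable_obs.comp measurable_fst)))
    (fun t => (hcond' t).measurable_obs) (fun t p => ?_) hinit' fun t => ?_⟩
  · rw [init_simulate, hinit]
    rfl
  · have htrunc : MeasurePreserving (fun (r : ℕ → unitInterval) (i : Fin t) => r i)
        (Measure.infinitePi fun _ => volume) (Measure.pi fun _ => volume) :=
      ⟨by fun_prop, by
        rw [← Measure.infinitePi_eq_pi]
        exact Measure.map_infinitePi_infinitePi_of_inj Fin.val_injective⟩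
    exact (identDistrib_comp_of_measurePreserving ((MeasurePreserving.id P).prod htrunc)
      (hlaw t).aemeasurable_fst).trans (hlaw t)

/-! ### Derandomization -/

lemma coe_le_ennreal_sub_iff {a b : ℝ≥0∞} (hb : b ≠ ∞) (c : ℝ) :
    (c : EReal) ≤ (a : EReal) - (b : EReal) ↔
      b + ENNReal.ofReal c ≤ a + ENNReal.ofReal (-c) := by
  induction a with
  | top => lift b to ℝ≥0 using hb; simp
  | coe a =>
    lift b to ℝ≥0 using hb
    have hsub : ((a : ℝ≥0∞) : EReal) - ((b : ℝ≥0∞) : EReal) = ((a - b : ℝ) : EReal) := rfl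
    rw [hsub, EReal.coe_le_coe_iff]
    simp only [ENNReal.ofReal, ← ENNReal.coe_add, ENNReal.coe_le_coe, ← NNReal.coe_le_coe,
      NNReal.coe_add, Real.coe_toNNReal']
    grind

lemma exists_le_sub_of_le_lintegral_sub {R : Type*} [MeasurableSpace R] {ρ : Measure R}
    [IsProbabilityMeasure ρ] {p n : R → ℝ≥0∞} (hn : AEMeasurable n ρ) {c : ℝ}
    (h : (c : EReal) ≤ ((∫⁻ r, p r ∂ρ : ℝ≥0∞) : EReal) - ((∫⁻ r, n r ∂ρ : ℝ≥0∞) : EReal)) :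
    ∃ r, (c : EReal) ≤ (p r : EReal) - (n r : EReal) := by
  have hnfin : ∫⁻ r, n r ∂ρ ≠ ∞ := by
    intro htop
    simp [htop] at h
  rw [coe_le_ennreal_sub_iff hnfin] at h
  by_contra! hlt
  have hae : ∀ᵐ r ∂ρ, p r + ENNReal.ofReal (-c) < n r + ENNReal.ofReal c := by
    filter_upwards [ae_lt_top' hn hnfin] with r hr
    exact not_le.1 (mt (coe_le_ennreal_sub_iff hr.ne c).2 (hlt r).not_ge)
  have hadd (q : R → ℝ≥0∞) (d : ℝ) :
      ∫⁻ r, q r + ENNReal.ofReal d ∂ρ = ∫⁻ r, q r ∂ρ + ENNReal.ofReal d := by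
    rw [lintegral_add_right _ measurable_const, lintegral_const, measure_univ, mul_one]
  have hfin : ∫⁻ r, p r + ENNReal.ofReal (-c) ∂ρ ≠ ∞ :=
    ((lintegral_mono_ae (ae_le_of_ae_lt hae)).trans_lt (by
      simpa only [hadd] using ENNReal.add_lt_top.2 ⟨hnfin.lt_top, ENNReal.ofReal_lt_top⟩)).ne
  have hstrict := lintegral_strict_mono (IsProbabilityMeasure.ne_zero ρ) (by fun_prop) hfin hae
  simp only [hadd] at hstrict
  exact hstrict.not_ge h

/-! ### Optimality -/

namespace InfoEnv.IsTotallyOptimal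

variable [NeZero K] {E : InfoEnv K} {S : AcqStrategy K B} {Act : ℕ → Type*}
  [∀ t, MeasurableSpace (Act t)]

lemma exists_condGaussian_history (hS : E.IsTotallyOptimal S) (t : ℕ) :
    ∃ m, CondGaussian (E.law B) (fun ω => E.history S ω t) (fun ω => ω.1 0) m
      fun _ => E.posteriorVar (S.division t 0) := by
  obtain ⟨m, hm⟩ := E.exists_condGaussian_history S t
  have hconst (h : Fin t → Fin B → ℝ) :
      E.posteriorVar (S.division t h) = E.posteriorVar (S.division t 0) :=
    (hS t h _ (S.sum_division t 0)).antisymm (hS t 0 _ (S.sum_division t h))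
  simp only [hconst] at hm
  exact ⟨m, hm⟩

lemma exists_randomized_decision (hS : E.IsTotallyOptimal S) (S' : AcqStrategy K B)
    (A' : DecisionStrategy B Act) :
    ∃ A : (ℕ → unitInterval) → DecisionStrategy B Act,
      ∀ U : ((t : ℕ) → Act t) → ℝ → ℝ, Measurable (Function.uncurry U) →
        IdentDistrib (fun p => E.payoff U S (A p.2) p.1) (E.payoff U S' A')
          ((E.law B).prod (Measure.infinitePi fun _ => volume)) (E.law B) := by
  choose m hm using hS.exists_condGaussian_history
  choose m' hm' using E.exists_condGaussian_history S'
  obtain ⟨Φ, hΦ, hlaw⟩ := exists_simulation_sequence (fun t ω => E.init_history S ω t)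
    (fun t ω => E.init_history S' ω t) hm hm' (fun t => E.posteriorVar_nonneg _)
    fun t h => hS t 0 _ (S'.sum_division t h)
  let A (r : ℕ → unitInterval) : DecisionStrategy B Act :=
    { act := fun t h => A'.act t (Φ (t + 1) r h)
      measurable_act := fun t => (A'.measurable_act t).comp ((hΦ (t + 1)).of_uncurry_left) }
  refine ⟨A, fun U hU => ?_⟩
  have hact (t : ℕ) := A'.measurable_act t
  have hactions : Measurable fun q : ((t : ℕ) → Fin t → Fin B → ℝ) × ℝ =>
      ((fun t => A'.act t (q.1 (t + 1))), q.2) := by fun_prop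
  exact hlaw.comp (hU.comp hactions)

lemma exists_coe_le_expectedPayoff (hS : E.IsTotallyOptimal S)
    {U : ((t : ℕ) → Act t) → ℝ → ℝ} (hU : Measurable (Function.uncurry U)) {S' : AcqStrategy K B}
    {A' : DecisionStrategy B Act} {c : ℝ} (hc : (c : EReal) ≤ E.expectedPayoff U S' A') :
    ∃ A : DecisionStrategy B Act, (c : EReal) ≤ E.expectedPayoff U S A := by
  obtain ⟨A, hA⟩ := hS.exists_randomized_decision S' A'
  have haverage {φ : ℝ → ℝ≥0∞} (hφ : Measurable φ) :
      AEMeasurable (fun r => ∫⁻ ω, φ (E.payoff U S (A r) ω) ∂E.law B)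
          (Measure.infinitePi fun _ => volume) ∧
        ∫⁻ ω, φ (E.payoff U S' A' ω) ∂E.law B =
          ∫⁻ r, ∫⁻ ω, φ (E.payoff U S (A r) ω) ∂E.law B ∂Measure.infinitePi fun _ => volume := by
    have hφA := (hA U hU).comp hφ
    exact ⟨hφA.aemeasurable_fst.lintegral_prod_left',
      hφA.lintegral_eq.symm.trans (lintegral_prod_symm _ hφA.aemeasurable_fst)⟩
  have hpos := haverage ENNReal.measurable_ofReal
  have hneg := haverage (ENNReal.measurable_ofReal.comp measurable_neg)
  simp only [Function.comp_apply] at hneg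
  rw [expectedPayoff, hpos.2, hneg.2] at hc
  obtain ⟨r, hr⟩ := exists_le_sub_of_le_lintegral_sub hneg.1 hc
  exact ⟨A r, hr⟩

lemma exists_expectedPayoff_le (hS : E.IsTotallyOptimal S)
    {U : ((t : ℕ) → Act t) → ℝ → ℝ} (hU : Measurable (Function.uncurry U)) {S' : AcqStrategy K B}
    {A' : DecisionStrategy B Act} (htop : E.expectedPayoff U S' A' ≠ ⊤) :
    ∃ A : DecisionStrategy B Act, E.expectedPayoff U S' A' ≤ E.expectedPayoff U S A := by
  by_cases hbot : E.expectedPayoff U S' A' = ⊥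
  · exact ⟨A', hbot ▸ bot_le⟩
  · simpa only [EReal.coe_toReal htop hbot] using
      hS.exists_coe_le_expectedPayoff hU (EReal.coe_toReal htop hbot).le

lemma expectedPayoff_le_iSup (hS : E.IsTotallyOptimal S) {U : ((t : ℕ) → Act t) → ℝ → ℝ}
    (hU : Measurable (Function.uncurry U)) (S' : AcqStrategy K B) (A' : DecisionStrategy B Act) :
    E.expectedPayoff U S' A' ≤ ⨆ A : DecisionStrategy B Act, E.expectedPayoff U S A := by
  refine EReal.ge_of_forall_gt_iff_ge.1 fun c hc => ?_
  obtain ⟨A, hA⟩ := hS.exists_coe_le_expectedPayoff hU hc.le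
  exact le_iSup_of_le A hA

end InfoEnv.IsTotallyOptimal

end

theorem theorem2_general {K : ℕ} [NeZero K] (E : InfoEnv K) {B : ℕ} {S : AcqStrategy K B}
    (hS : E.IsTotallyOptimal S) :
    E.IsMyopic S ∧
      ∀ (Act : ℕ → Type*) [∀ t, MeasurableSpace (Act t)]
        (U : ((t : ℕ) → Act t) → ℝ → ℝ), Measurable (Function.uncurry U) →
        (∀ (S' : AcqStrategy K B) (A' : DecisionStrategy B Act),
          E.expectedPayoff U S' A' ≤ ⨆ A : DecisionStrategy B Act, E.expectedPayoff U S A) ∧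
        (∀ (S' : AcqStrategy K B) (A' : DecisionStrategy B Act), E.expectedPayoff U S' A' ≠ ⊤ →
          ∃ A : DecisionStrategy B Act, E.expectedPayoff U S' A' ≤ E.expectedPayoff U S A) ∧
        ((∃ (S' : AcqStrategy K B) (A' : DecisionStrategy B Act),
            E.IsOptimal U S' A' ∧ E.expectedPayoff U S' A' ≠ ⊤) →
          ∃ A : DecisionStrategy B Act, E.IsOptimal U S A) := by
  refine ⟨hS.isMyopic, fun Act _ U hU =>
    ⟨hS.expectedPayoff_le_iSup hU, fun _ _ => hS.exists_expectedPayoff_le hU, ?_⟩⟩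
  rintro ⟨S', A', hopt, htop⟩
  obtain ⟨A, hA⟩ := hS.exists_expectedPayoff_le hU htop
  exact ⟨A, fun S'' A'' => (hopt S'' A'').trans hA⟩

theorem theorem2 {K : ℕ} [NeZero K] (E : InfoEnv K) (hE : E.NonRedundant)
    (hsep : E.Separable) (B : ℕ) (hB : 0 < B) :
    ∃ S : AcqStrategy K B, E.IsMyopic S ∧
      ∀ (Act : ℕ → Type*) [∀ t, MeasurableSpace (Act t)]
        (U : ((t : ℕ) → Act t) → ℝ → ℝ), Measurable (Function.uncurry U) →
        (∀ (S' : AcqStrategy K B) (A' : DecisionStrategy B Act),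
          E.expectedPayoff U S' A' ≤ ⨆ A : DecisionStrategy B Act, E.expectedPayoff U S A) ∧
        (∀ (S' : AcqStrategy K B) (A' : DecisionStrategy B Act), E.expectedPayoff U S' A' ≠ ⊤ →
          ∃ A : DecisionStrategy B Act, E.expectedPayoff U S' A' ≤ E.expectedPayoff U S A) ∧
        ((∃ (S' : AcqStrategy K B) (A' : DecisionStrategy B Act),
            E.IsOptimal U S' A' ∧ E.expectedPayoff U S' A' ≠ ⊤) →
          ∃ A : DecisionStrategy B Act, E.IsOptimal U S A) := by
  obtain ⟨S, hS⟩ := hsep.exists_isTotallyOptimal B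
  exact ⟨S, theorem2_general E hS⟩
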